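/- **Notation.** Let $\mathbb{YF}$ be the set of finite words over $\{1,2\}$, with empty word $\varepsilon$. For a word $v$ let $|v|$ be the sum of its digits, $\#v$ the number of its digits and $d(v)$ the number of its twos. For words $v,w$ let $v_w$ be the word obtained from $v$ by deleting its longest common suffix with $w$. Order $\mathbb{YF}$ by $w\le v \iff d(v_w)\ge \#w_v$ (the Young–Fibonacci lattice). Fix an integer $K\ge 0$ and let $\mathbb{YF}^K=\{v : d(v)\le K\}$. The jump graph $\overline{\mathbb{YF}}^K$ has the root $(\varepsilon,0)$ as its only vertex of level $0$, the vertices $(v,n)$, $v\in\mathbb{YF}^K$, on each level $n\ge1$, and an edge from $(w,n)$ to $(v,n+1)$ exactly when $w\le v$. Let $D(w,v,n)$ be the number of paths with $n$ edges from a vertex $(w,l)$ to $(v,l+n)$ (it does not depend on $l$, and it is $0$ for $n<0$). For $w\le v$ define polynomials $Q_{w,v}$ in $p$ recursively. For $w=\varepsilon$: $$Q_{\varepsilon,\varepsilon}=1,\qquad Q_{\varepsilon,1v}=Q_{\varepsilon,v},\qquad Q_{\varepsilon,2v}=(1-p)\,(p\,Q_{\varepsilon,v})'+(|v|+1)\,p\,Q_{\varepsilon,v}.$$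 For $w\ne\varepsilon$: $Q_{w,v}=1$ if $d(v_w)=\#w_v$; otherwise $Q_{w,1v}=Q_{w,v}$, and for $w=w_0w'$ with $w_0\in\{1,2\}$, $$Q_{w,2v}=p(1-p)\,Q_{w,v}'+(|v|+1-|w|)\,p\,Q_{w,v}+Q_{w',v}.$$ A sequence $V(m)=(v(m),n(m))$ of vertices of $\overline{\mathbb{YF}}^K$ has the limit function $\mu_V$ if for all vertices $(w,l)$ the limit $$\mu_V(w,l)=\lim_{m\to\infty}D(\varepsilon,w,l)\,\frac{D(w,v(m),n(m)-l)}{D(\varepsilon,v(m),n(m))}$$ exists. A measure on the space of infinite paths from the root in $\overline{\mathbb{YF}}^K$ is *central* if, for every $n$, all initial segments of length $n$ with the same end vertex are equiprobable. **Theorem.** For $v^k=21^{c_{k-1}}2\ldots 21^{c_1}21^{c_0}$ with $0\le k\le K$ and $c_i\in\mathbb{N}_0$ ($v^0=\varepsilon$), and for $p\in(0,1)$, define a function on the vertices by $$\mu_{v^k,p}(w,l)=\begin{cases}D(\varepsilon,w,l)\,p^l(1-p)^{|w|}\,\dfrac{Q_{w,v^k}(p)}{Q_{\varepsilon,v^k}(p)}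 & \text{if } w\le v^k,\\[2mm] D(\varepsilon,w,l)\,p^l(1-p)^{|w|}\,\dfrac{1}{Q_{\varepsilon,v^k}(p)} & \text{if } w=1^Wv^k \text{ for some } W\ge1,\\[2mm] 0&\text{otherwise.}\end{cases}$$ Moreover let $\mu_0$ be $1$ at the root and $0$ at all vertices of positive level (the case $p=0$), and let $\mu_1(\varepsilon,l)=1$ and $\mu_1(w,l)=0$ for $w\ne\varepsilon$ (the case $p=1$). 1. If the levels $n(m)$ of a sequence $V$ of vertices are unbounded and $V$ has a limit function, then it is one of the $\mu_{v^k,p}$, $\mu_0$, $\mu_1$. Each of these functions is the limit function of a sequence of vertices whose levels tend to infinity. 2. Let $n(m)\to\infty$ and $\frac{n(m)}{n(m)+\#v(m)}\to p\in[0,1]$. If $p=0$, the limit function of $V$ exists and is $\mu_0$; if $p=1$, it exists and is $\mu_1$; if $p\in(0,1)$ and for every $N$ the word $1^Nv^k$ is a suffix of $v(m)$ for all large $m$, it exists and is $\mu_{v^k,p}$. 3. The words $v^k$ with $k\le K$ are exactly $\varepsilon$ and the words $2u$ with $d(u)\le K-1$. 4. For every $v^k$ and $p\in(0,1)$ there is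 exactly one central probability measure on the space of infinite paths in $\overline{\mathbb{YF}}^K$ for which the set of the paths through $(w,l)$ has measure $\mu_{v^k,p}(w,l)$ for all vertices $(w,l)$. The same holds for $\mu_1$. In the degenerate case $p=0$ all mass escapes: the zero measure is the only measure on the path space for which the set of the paths through $(w,l)$ has measure $\mu_0(w,l)$ for all vertices with $l\ge1$. 5. All these are distinct: $\mu_{v^k,p}$ determines $k$, $c_0,\dots,c_{k-1}$ and $p$, it differs from $\mu_0$ and $\mu_1$, and $\mu_0\ne\mu_1$. -/

import Mathlib

open Filter Topology MeasureTheory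

namespace JumpYF

open Polynomial

inductive Digit where
  | one
  | two
  deriving DecidableEq

/-- Words over `{1, 2}`; the head of the list is the leftmost digit. -/
abbrev Word : Type := List Digit

/-- `d(v)`: the number of twos in `v`. -/
def twos (v : Word) : ℕ := v.count Digit.two

/-- `|v|`: the sum of the digits of `v`. -/
def weight : Word → ℕ
  | [] => 0
  | Digit.one :: v => weight v + 1
  | Digit.two :: v => weight v + 2

/-- Delete from the first word its longest common prefix with the second one. -/
def stripPrefix : Word → Word → Word
  | [], _ => []
  | a :: v, [] => a :: v
  | a :: v, b :: w => if a = b then stripPrefix v w else a :: v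

/-- `v_w`: the word `v` with its longest common suffix with `w` deleted. -/
def strip (v w : Word) : Word := (stripPrefix v.reverse w.reverse).reverse

/-- The Young–Fibonacci order: after deletion of the longest common suffix, at least as many twos
remain in `y` as digits remain in `x`. -/
def Below (x y : Word) : Prop := (strip x y).length ≤ twos (strip y x)

/-- `D(w, v, n)`: the number of sequences `w = v₀ ≤ v₁ ≤ … ≤ vₙ = v`, i.e. of paths with `n` edges
in the jump graph from the word `w` to the word `v`. All words of such a sequence lie below `v`,
so there are finitely many of them, and none of them has more twos than `v`. -/
noncomputable def D (w v : Word) (n : ℕ) : ℕ :=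
  Nat.card {x : Fin (n + 1) → Word //
    x 0 = w ∧ x (Fin.last n) = v ∧ ∀ i : Fin n, Below (x i.castSucc) (x i.succ)}

/-- The polynomial `Q_{ε,v}`. -/
noncomputable def Qroot : Word → ℝ[X]
  | [] => 1
  | Digit.one :: v => Qroot v
  | Digit.two :: v =>
      (1 - X) * derivative (X * Qroot v) + C ((weight v : ℝ) + 1) * X * Qroot v

/-- The polynomial `Q_{w,v}`; it is meaningful only for `Below w v`. -/
noncomputable def Q : Word → Word → ℝ[X]
  | [], v => Qroot v
  | _ :: _, [] => 0
  | a :: w, Digit.one :: v =>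
      if twos (strip (Digit.one :: v) (a :: w)) = (strip (a :: w) (Digit.one :: v)).length then 1
      else Q (a :: w) v
  | a :: w, Digit.two :: v =>
      if twos (strip (Digit.two :: v) (a :: w)) = (strip (a :: w) (Digit.two :: v)).length then 1
      else
        X * (1 - X) * derivative (Q (a :: w) v)
          + C ((weight v : ℝ) + 1 - (weight (a :: w) : ℝ)) * X * Q (a :: w) v + Q w v

/-- Vertices of the jump graph over the words with at most `K` twos: a word and a level, where
the only vertex of level `0` is the root `(ε, 0)`. -/
@[ext]
structure Vertex (K : ℕ) where
  word : Word
  level : ℕ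
  twos_le : twos word ≤ K
  root : level = 0 → word = []

/-- The number of paths between two vertices of the jump graph (none if the first vertex has the
larger level). -/
noncomputable def pathCount {K : ℕ} (x y : Vertex K) : ℕ :=
  if x.level ≤ y.level then D x.word y.word (y.level - x.level) else 0

/-- The proportion of the paths from the root to `y` that pass through `x`. -/
noncomputable def proportion {K : ℕ} (x y : Vertex K) : ℝ :=
  (D [] x.word x.level : ℝ) * ((pathCount x y : ℝ) / (D [] y.word y.level : ℝ))

/-- `μ` is the limit function `μ_V` on the vertices of the sequence of vertices `V`. -/
def IsLimit {K : ℕ} (V : ℕ → Vertex K) (μ : Vertex K → ℝ) : Prop :=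
  ∀ x : Vertex K, Tendsto (fun m => proportion x (V m)) atTop (𝓝 (μ x))

/-- The word `2 1^{c_{k-1}} 2 … 2 1^{c_0}` for the list `[c_{k-1}, …, c_0]`. -/
def paramWord : List ℕ → Word
  | [] => []
  | c :: cs => Digit.two :: (List.replicate c Digit.one ++ paramWord cs)

open Classical in
/-- The value of `μ_{v,p}` at the vertices. -/
noncomputable def mu {K : ℕ} (v : Word) (p : ℝ) (x : Vertex K) : ℝ :=
  if Below x.word v then
    (D [] x.word x.level : ℝ) * p ^ x.level * (1 - p) ^ weight x.word
      * ((Q x.word v).eval p / (Q [] v).eval p)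
  else if ∃ W : ℕ, 1 ≤ W ∧ x.word = List.replicate W Digit.one ++ v then
    (D [] x.word x.level : ℝ) * p ^ x.level * (1 - p) ^ weight x.word
      * (1 / (Q [] v).eval p)
  else 0

/-- The degenerate case `p = 0`: value `1` at the root and `0` at all vertices of positive
level. -/
def muZero {K : ℕ} (x : Vertex K) : ℝ := if x.level = 0 then 1 else 0

/-- The degenerate case `p = 1`: value `1` at the vertices `(ε, l)` and `0` at all others. -/
def muOne {K : ℕ} (x : Vertex K) : ℝ := if x.word = [] then 1 else 0

/-- Infinite paths from the root in the jump graph over the words with at most `K` twos. -/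
def PathSpace (K : ℕ) : Type :=
  {x : ℕ → Word // x 0 = [] ∧ ∀ i, twos (x i) ≤ K ∧ Below (x i) (x (i + 1))}

/-- The set of the infinite paths through a given vertex. -/
def through {K : ℕ} (x : Vertex K) : Set (PathSpace K) := {z | z.1 x.level = x.word}

/-- The set of the infinite paths with the same first `n` edges as `y`. -/
def cylinder {K : ℕ} (y : PathSpace K) (n : ℕ) : Set (PathSpace K) :=
  {z | ∀ i ≤ n, z.1 i = y.1 i}

/-- The σ-algebra generated by the sets `through x`. -/
instance (K : ℕ) : MeasurableSpace (PathSpace K) :=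
  MeasurableSpace.generateFrom (Set.range through)

/-- Centrality: all initial segments of a path with a given end vertex are equiprobable. -/
def IsCentral {K : ℕ} (M : Measure (PathSpace K)) : Prop :=
  ∀ (n : ℕ) (y z : PathSpace K), y.1 n = z.1 n → M (cylinder y n) = M (cylinder z n)

/-- There is exactly one central probability measure on the path space for which the measure of
the set of the paths through any vertex `x` is `μ x`. -/
def HasCentralMeasure {K : ℕ} (μ : Vertex K → ℝ) : Prop :=
  ∃! M : Measure (PathSpace K), IsProbabilityMeasure M ∧ IsCentral M ∧
    ∀ x : Vertex K, M (through x) = ENNReal.ofReal (μ x)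

end JumpYF

open JumpYF

/-! Up to the factor D(ε,w,l), the limit functions describe the asymptotics of the ratios
D(w,v,n-l)/D(ε,v,n). The order obeys two recursions on the larger word, `below_one` and `below_two`.
They express the numbers of chains ending at 1v or 2v through those ending at v, by partial sums and
by multiplication with the length. On generating functions these operations are division by 1-X and
the Euler operator X·d/dX, and `gen_eq` follows: the nonempty chains from w to v have the generating
function X(1-X)^(|w|-|v|-1) Q_{w,v}(X). So the polynomials Q are the numerators over the pole at 1.

For the root, `cnt_ratio` shows that lowering n by one multiplies D(ε,v,n) asymptotically by
n/(n+#v), because the number of twos is bounded. A shift by l thus becomes the factor p^l, which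
already settles p = 0 and p = 1. For 0 < p < 1 the words have the form x1^Nv with N large. By
`gen_replicate_append`, the counts for 1^Nv are a fixed polynomial in the shift, essentially
(1-X)^|w| Q_{w,v}, applied to the root counts of 1^(N+|v|). The prefix x acts by the operator
`prefixL x`. This operator commutes with shifts, and is compatible with replacing ε by w, up to
errors in which a two of x is turned into a one (`shiftL_prefixL_le`, `abs_cnt_sub_le`). Such a
replacement loses a factor of order N (`replace_two`) and x has at most K twos, so the error
vanishes in the limit, the shift becomes the number p, and `tendsto_cnt_div` results.

Conversely, every sequence with unbounded levels has a subsequence along which n/(n+#v) converges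
and, since there are at most K twos, the words end in ever longer blocks of ones followed by one
fixed v^k (`exists_frequently_suffix`). A limit function is unchanged on subsequences.

For the measures, splitting off the first edge of a chain gives the identity `poly_eq_sum`. It
yields the positivity of Q on (0,1) and, with a geometric series for the words 1^Wv, harmonicity
(`hasSum_psi`). A normalised nonnegative harmonic function defines a Markov chain in which the
probability of an initial segment depends only on its end, which is centrality. Uniqueness holds
because the paths through a vertex split into D(ε,w,l) equiprobable cylinders. Finally, the support
on level 1 determines v^k, and the value at (ε,1) is p. -/

namespace JumpYF

open Polynomial

open scoped PowerSeries

/-! ### The order as a recursion on the leading digit -/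

/-- The order condition on reversed words. -/
def BelowRev (A B : Word) : Prop := (stripPrefix A B).length ≤ twos (stripPrefix B A)

/-- The number of twos left in `v` equals the number of digits left in `w`. -/
def Tight (w v : Word) : Prop := twos (strip v w) = (strip w v).length

/-- `Tight` on reversed words. -/
def TightRev (A B : Word) : Prop := twos (stripPrefix B A) = (stripPrefix A B).length

@[simp] theorem stripPrefix_nil_right (v : Word) : stripPrefix v [] = v := by
  cases v <;> rfl

@[simp] theorem twos_nil : twos [] = 0 := rfl
@[simp] theorem twos_one (v : Word) : twos (Digit.one :: v) = twos v := by simp [twos]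
@[simp] theorem twos_two (v : Word) : twos (Digit.two :: v) = twos v + 1 := by simp [twos]
@[simp] theorem twos_append (v w : Word) : twos (v ++ w) = twos v + twos w := by simp [twos]
@[simp] theorem twos_reverse (v : Word) : twos v.reverse = twos v := by simp [twos]
@[simp] theorem twos_replicate (n : ℕ) : twos (List.replicate n Digit.one) = 0 := by
  simp [twos, List.count_replicate]

theorem below_iff_rev (w v : Word) : Below w v ↔ BelowRev w.reverse v.reverse := by
  simp [Below, BelowRev, strip]

theorem tight_iff_rev (w v : Word) : Tight w v ↔ TightRev w.reverse v.reverse := by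
  simp [Tight, TightRev, strip]

/-- Induction along the common prefix. After a first mismatch the appended one does not change the
number of twos; it matters only if `A` contains all of `B` as a prefix. -/
theorem belowRev_append_one (A B : Word) :
    BelowRev A (B ++ [Digit.one]) ↔ A = B ++ [Digit.one] ∨ BelowRev A B := by
  induction A generalizing B with
  | nil => simp [BelowRev, stripPrefix]
  | cons c A ih =>
    cases B with
    | nil => cases c <;> cases A <;> simp [BelowRev, stripPrefix]
    | cons e B =>
      by_cases h : c = e
      · subst h; simpa [BelowRev, stripPrefix] using ih B
      · have h' : ¬ e = c := fun q => h q.symm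
        simp only [BelowRev, List.cons_append, stripPrefix, if_neg h', List.cons.injEq, h,
          if_false, false_and, false_or]
        rw [← List.cons_append, twos_append]
        simp

theorem tightRev_append_one (A B : Word) :
    TightRev A (B ++ [Digit.one]) ↔ A = B ++ [Digit.one] ∨ TightRev A B := by
  induction A generalizing B with
  | nil =>
    have := twos_append B [Digit.one]
    cases B <;> simp_all [TightRev, stripPrefix]
  | cons c A ih =>
    cases B with
    | nil => cases c <;> cases A <;> simp [TightRev, stripPrefix]
    | cons e B =>
      by_cases h : c = e
      · subst h; simpa [TightRev, stripPrefix] using ih B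
      · have h' : ¬ e = c := fun q => h q.symm
        simp only [TightRev, List.cons_append, stripPrefix, if_neg h', List.cons.injEq, h,
          if_false, false_and, false_or]
        rw [← List.cons_append, twos_append]
        simp

theorem belowRev_append_two (a : Digit) (A B : Word) :
    BelowRev (A ++ [a]) (B ++ [Digit.two]) ↔ BelowRev A B := by
  induction A generalizing B with
  | nil =>
    cases B with
    | nil => cases a <;> simp [BelowRev, stripPrefix]
    | cons e B =>
      by_cases h : a = e
      · subst h; simp [BelowRev, stripPrefix]
      · have h' : ¬ e = a := fun q => h q.symm
        cases e <;> simp [BelowRev, stripPrefix, h, h']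
  | cons c A ih =>
    cases B with
    | nil => cases c <;> simp [BelowRev, stripPrefix]
    | cons e B =>
      by_cases h : c = e
      · subst h; simpa [BelowRev, stripPrefix] using ih B
      · have h' : ¬ e = c := fun q => h q.symm
        simp only [BelowRev, List.cons_append, stripPrefix, if_neg h, if_neg h',
          List.length_cons]
        rw [← List.cons_append, twos_append]
        simp

/-- After a first mismatch, deleting both last letters lowers both counts by one, while deleting
only the two lowers just one of them and destroys the inequality. -/
theorem tightRev_append_two {a : Digit} {A B : Word}
    (h : TightRev (A ++ [a]) (B ++ [Digit.two])) : TightRev A B ∧ ¬ BelowRev (A ++ [a]) B := by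
  induction A generalizing B with
  | nil =>
    cases B with
    | nil => simp [TightRev, BelowRev, stripPrefix]
    | cons e B =>
      by_cases h1 : a = e
      · subst h1; simp [TightRev, stripPrefix] at h
      · have h' : ¬ e = a := fun q => h1 q.symm
        have := twos_append B [Digit.two]
        cases e <;> simp_all [BelowRev, TightRev, stripPrefix]
  | cons c A ih =>
    cases B with
    | nil => cases c <;> simp [TightRev, stripPrefix] at h
    | cons e B =>
      by_cases h1 : c = e
      · subst h1
        have := @ih B (by simpa [TightRev, stripPrefix] using h)
        simpa [TightRev, BelowRev, stripPrefix] using this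
      · have h' : ¬ e = c := fun q => h1 q.symm
        simp only [TightRev, BelowRev, List.cons_append, stripPrefix, if_neg h1, if_neg h',
          List.length_cons] at h ⊢
        rw [← List.cons_append, twos_append] at h
        simp at h ⊢
        omega

theorem below_nil (v : Word) : Below [] v := by
  simp [below_iff_rev, BelowRev, stripPrefix]

theorem below_nil_right {w : Word} : Below w [] ↔ w = [] := by
  rw [below_iff_rev, List.reverse_nil, ← List.reverse_eq_nil_iff]
  cases w.reverse <;> simp [BelowRev, stripPrefix]

/-- Together with `below_two` this determines the order by recursion on the larger word.
Transitivity, antisymmetry and the monotonicity of weight and number of twos all follow by induction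
from these two rules. -/
theorem below_one {w v : Word} :
    Below w (Digit.one :: v) ↔ w = Digit.one :: v ∨ Below w v := by
  rw [below_iff_rev, below_iff_rev, List.reverse_cons, belowRev_append_one,
    ← List.reverse_cons, List.reverse_inj]

theorem below_two {a : Digit} {w v : Word} :
    Below (a :: w) (Digit.two :: v) ↔ Below w v := by
  rw [below_iff_rev, below_iff_rev, List.reverse_cons, List.reverse_cons, belowRev_append_two]

theorem tight_nil {v : Word} : Tight [] v ↔ twos v = 0 := by
  rw [tight_iff_rev, List.reverse_nil, ← twos_reverse]
  cases v.reverse <;> simp [TightRev, stripPrefix]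

theorem not_tight_nil_right {a : Digit} {w : Word} : ¬ Tight (a :: w) [] := by
  rw [tight_iff_rev, List.reverse_nil]
  have : (a :: w).reverse ≠ [] := by simp
  revert this
  cases (a :: w).reverse <;> simp [TightRev, stripPrefix]

theorem tight_one {w v : Word} :
    Tight w (Digit.one :: v) ↔ w = Digit.one :: v ∨ Tight w v := by
  rw [tight_iff_rev, tight_iff_rev, List.reverse_cons, tightRev_append_one,
    ← List.reverse_cons, List.reverse_inj]

theorem Tight.of_two {a : Digit} {w v : Word} (h : Tight (a :: w) (Digit.two :: v)) :
    Tight w v ∧ ¬ Below (a :: w) v := by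
  rw [tight_iff_rev, List.reverse_cons, List.reverse_cons] at h
  rw [tight_iff_rev, below_iff_rev, List.reverse_cons]
  exact tightRev_append_two h

theorem Below.refl (v : Word) : Below v v := by
  induction v with
  | nil => exact below_nil _
  | cons a v ih =>
    cases a
    · exact below_one.2 (Or.inl rfl)
    · exact below_two.2 ih

theorem Below.of_cons {a : Digit} {u v : Word} (h : Below (a :: u) v) : Below u v := by
  induction v generalizing a u with
  | nil => simp [below_nil_right] at h
  | cons b v ih =>
    cases b
    · rcases below_one.1 h with h | h
      · cases h; exact below_one.2 (Or.inr (Below.refl _))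
      · exact below_one.2 (Or.inr (ih h))
    · have h := below_two.1 h
      cases u with
      | nil => exact below_nil _
      | cons b u => exact below_two.2 (ih h)

theorem Below.cons {w v : Word} (h : Below w v) (a : Digit) : Below w (a :: v) := by
  cases a
  · exact below_one.2 (Or.inr h)
  · cases w with
    | nil => exact below_nil _
    | cons b w => exact below_two.2 h.of_cons

theorem Below.append {w v : Word} (h : Below w v) (x : Word) : Below w (x ++ v) := by
  induction x with
  | nil => exact h
  | cons a x ih => exact ih.cons a

theorem Below.trans {u w v : Word} (h : Below u w) (h' : Below w v) : Below u v := by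
  induction v generalizing u w with
  | nil => rw [below_nil_right] at h'; subst h'; exact h
  | cons b v ih =>
    cases b
    · rcases below_one.1 h' with rfl | h'
      · exact h
      · exact (ih h h').cons _
    · cases u with
      | nil => exact below_nil _
      | cons a u =>
        cases w with
        | nil => simp [below_nil_right] at h
        | cons b w =>
          refine below_two.2 ?_
          replace h' := below_two.1 h'
          cases b
          · rcases below_one.1 h with h | h
            · cases h; exact h'
            · exact ih h.of_cons h'
          · exact ih (below_two.1 h) h'

theorem Below.weight_le {w v : Word} (h : Below w v) : weight w ≤ weight v := by
  induction v generalizing w with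
  | nil => rw [below_nil_right] at h; subst h; exact le_rfl
  | cons b v ih =>
    cases b
    · rcases below_one.1 h with rfl | h
      · exact le_rfl
      · exact (ih h).trans (by simp [weight])
    · cases w with
      | nil => simp [weight]
      | cons a w =>
        have := ih (below_two.1 h)
        cases a <;> simp only [weight] <;> omega

theorem Below.twos_le {w v : Word} (h : Below w v) : twos w ≤ twos v := by
  induction v generalizing w with
  | nil => rw [below_nil_right] at h; subst h; exact le_rfl
  | cons b v ih =>
    cases b
    · rcases below_one.1 h with rfl | h
      · exact le_rfl
      · exact (ih h).trans (by simp)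
    · cases w with
      | nil => simp
      | cons a w =>
        have := ih (below_two.1 h)
        cases a <;> simp only [twos_one, twos_two] <;> omega

theorem Below.eq_of_weight {w v : Word} (h : Below w v) (hw : weight v ≤ weight w) : w = v := by
  induction v generalizing w with
  | nil => exact below_nil_right.1 h
  | cons b v ih =>
    cases b
    · rcases below_one.1 h with h | h
      · exact h
      · have := h.weight_le
        simp only [weight] at hw; omega
    · cases w with
      | nil => simp [weight] at hw
      | cons a w =>
        replace h := below_two.1 h
        have := h.weight_le
        cases a
        · simp only [weight] at hw; omega
        · rw [ih h (by simpa [weight] using hw)]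

theorem Below.antisymm {w v : Word} (h : Below w v) (h' : Below v w) : w = v :=
  h.eq_of_weight h'.weight_le

/-! ### Finite down-sets and numbers of chains -/

/-- The words below `v`. -/
def down : Word → Finset Word
  | [] => {[]}
  | Digit.one :: v => insert (Digit.one :: v) (down v)
  | Digit.two :: v => insert [] ((down v).image (List.cons Digit.one) ∪
      (down v).image (List.cons Digit.two))

theorem mem_down {w v : Word} : w ∈ down v ↔ Below w v := by
  induction v generalizing w with
  | nil => simp [down, below_nil_right]
  | cons b v ih =>
    cases b
    · simp [down, below_one, ih]
    · cases w with
      | nil => simp [down, below_nil]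
      | cons a w => cases a <;> simp [down, below_two, ih]

theorem D_zero (w v : Word) : D w v 0 = if w = v then 1 else 0 := by
  unfold D
  split_ifs with h
  · subst h
    have : Unique {x : Fin (0 + 1) → Word //
        x 0 = w ∧ x (Fin.last 0) = w ∧ ∀ i : Fin 0, Below (x i.castSucc) (x i.succ)} :=
      { default := ⟨fun _ => w, rfl, rfl, fun i => i.elim0⟩
        uniq := by
          rintro ⟨x, h1, -, -⟩
          apply Subtype.ext
          funext i
          rw [Fin.fin_one_eq_zero i]
          exact h1 }
    exact Nat.card_unique
  · have : IsEmpty {x : Fin (0 + 1) → Word //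
        x 0 = w ∧ x (Fin.last 0) = v ∧ ∀ i : Fin 0, Below (x i.castSucc) (x i.succ)} :=
      ⟨fun ⟨x, h1, h2, _⟩ => h (h1.symm.trans h2)⟩
    exact Nat.card_of_isEmpty

/-- The type of chains with `n` edges from `w` to `v`. -/
abbrev Chain (w v : Word) (n : ℕ) : Type :=
  {x : Fin (n + 1) → Word //
    x 0 = w ∧ x (Fin.last n) = v ∧ ∀ i : Fin n, Below (x i.castSucc) (x i.succ)}

theorem sigma_chain_ext {w v : Word} {n : ℕ} {y z : Σ u : {u // u ∈ down v}, Chain w u.1 n}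
    (h : y.2.1 = z.2.1) : y = z := by
  obtain ⟨⟨u, hu⟩, ⟨x, h1, h2, h3⟩⟩ := y
  obtain ⟨⟨u', hu'⟩, ⟨x', h1', h2', h3'⟩⟩ := z
  obtain rfl : x = x' := h
  obtain rfl : u = u' := h2.symm.trans h2'
  rfl

/-- Splitting off the last edge of a chain. -/
def chainEquiv (w v : Word) (n : ℕ) :
    Chain w v (n + 1) ≃ Σ u : {u // u ∈ down v}, Chain w u.1 n where
  toFun x := ⟨⟨x.1 (Fin.last n).castSucc, by
      have := x.2.2.2 (Fin.last n)
      rw [Fin.succ_last, x.2.2.1] at this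
      exact mem_down.2 this⟩,
    ⟨fun i => x.1 i.castSucc, x.2.1, rfl, fun i => x.2.2.2 i.castSucc⟩⟩
  invFun y := ⟨Fin.snoc (α := fun _ => Word) y.2.1 v, by
      refine ⟨?_, by simp, ?_⟩
      · exact (Fin.snoc_castSucc (α := fun _ => Word) v y.2.1 0).trans y.2.2.1
      · intro i
        refine Fin.lastCases ?_ (fun i => ?_) i
        · rw [Fin.snoc_castSucc, Fin.succ_last, Fin.snoc_last, y.2.2.2.1]
          exact mem_down.1 y.1.2
        · rw [Fin.snoc_castSucc, Fin.succ_castSucc, Fin.snoc_castSucc]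
          exact y.2.2.2.2 i⟩
  left_inv x := by
    apply Subtype.ext
    funext i
    refine Fin.lastCases ?_ (fun i => ?_) i
    · simp [x.2.2.1]
    · simp
  right_inv y := sigma_chain_ext (by simp)

theorem finite_chain (w v : Word) (n : ℕ) : Finite (Chain w v n) := by
  induction n generalizing v with
  | zero =>
    refine Finite.of_injective (β := Unit) (fun _ => ()) ?_
    rintro ⟨x, h1, -⟩ ⟨y, h2, -⟩ -
    apply Subtype.ext
    funext i
    obtain rfl : i = 0 := Fin.fin_one_eq_zero i
    exact h1.trans h2.symm
  | succ n ih =>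
    have := fun u => ih u
    exact Finite.of_equiv _ (chainEquiv w v n).symm

theorem D_succ (w v : Word) (n : ℕ) : D w v (n + 1) = ∑ u ∈ down v, D w u n := by
  have := fun u => finite_chain w u n
  rw [D, Nat.card_congr (chainEquiv w v n), Nat.card_sigma, ← Finset.sum_coe_sort (down v)]
  rfl

theorem D_eq_zero {w v : Word} (h : ¬ Below w v) (n : ℕ) : D w v n = 0 := by
  induction n generalizing v with
  | zero =>
    rw [D_zero, if_neg]
    rintro rfl
    exact h (Below.refl _)
  | succ n ih =>
    rw [D_succ]
    exact Finset.sum_eq_zero fun u hu => ih fun hw => h (hw.trans (mem_down.1 hu))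

theorem D_add (w v : Word) (l n : ℕ) :
    D w v (l + n) = ∑ u ∈ down v, D w u l * D u v n := by
  induction n generalizing v with
  | zero =>
    have : v ∈ down v := mem_down.2 (Below.refl v)
    simp [D_zero, this]
  | succ n ih =>
    simp only [← add_assoc, D_succ _ v, ih, Finset.mul_sum]
    rw [Finset.sum_comm' (t' := down v) (s' := fun u => (down v).filter fun z => u ∈ down z)]
    · refine Finset.sum_congr rfl fun u _ => ?_
      refine Finset.sum_subset (Finset.filter_subset _ _) fun z hz hz' => ?_
      rw [D_eq_zero (w := u), mul_zero]
      intro h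
      exact hz' (Finset.mem_filter.2 ⟨hz, mem_down.2 h⟩)
    · intro z u
      simp only [mem_down, Finset.mem_filter]
      exact ⟨fun h => ⟨h, h.2.trans h.1⟩, fun h => h.1⟩

open Classical in
theorem D_one (w v : Word) : D w v 1 = if Below w v then 1 else 0 := by
  simp [D_succ, D_zero, mem_down]

theorem D_self (v : Word) (n : ℕ) : D v v n = 1 := by
  induction n with
  | zero => simp [D_zero]
  | succ n ih =>
    rw [D_succ, Finset.sum_eq_single v, ih]
    · exact fun u hu hne => D_eq_zero (fun h => hne ((mem_down.1 hu).antisymm h)) n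
    · exact fun h => (h (mem_down.2 (Below.refl v))).elim

/-- For one edge this says that ε lies below every word, and further edges at the end preserve the
inequality. It fails for n = 0 and w = v ≠ ε, which is one reason why `cnt` drops the empty chain.
-/
theorem D_le_root (w v : Word) {n : ℕ} (hn : n ≠ 0) : D w v n ≤ D [] v n := by
  obtain ⟨n, rfl⟩ := Nat.exists_eq_succ_of_ne_zero hn
  clear hn
  induction n generalizing v with
  | zero =>
    simp only [Nat.succ_eq_add_one, zero_add, D_one, below_nil, if_true]
    split_ifs <;> simp
  | succ n ih =>
    rw [Nat.succ_eq_add_one, D_succ, D_succ [] v]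
    exact Finset.sum_le_sum fun u _ => ih u

theorem D_pos {w v : Word} (h : Below w v) {n : ℕ} (hn : n ≠ 0) : 0 < D w v n := by
  obtain ⟨n, rfl⟩ := Nat.exists_eq_succ_of_ne_zero hn
  rw [Nat.succ_eq_add_one, D_succ]
  refine Finset.sum_pos' (fun _ _ => Nat.zero_le _) ⟨w, mem_down.2 h, ?_⟩
  simp [D_self]

/-! ### Chain counts under a new leading digit -/

theorem D_one_cons (w v : Word) (n : ℕ) :
    D w (Digit.one :: v) n =
      (if w = Digit.one :: v then 1 else 0) + ∑ m ∈ Finset.range n, D w v (m + 1) := by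
  induction n with
  | zero => simp [D_zero]
  | succ n ih =>
    have : Digit.one :: v ∉ down v := fun h => by
      have := (mem_down.1 h).weight_le
      simp [weight] at this
    rw [D_succ, down, Finset.sum_insert this, ← D_succ, ih, Finset.sum_range_succ, add_assoc]

theorem sum_down_two {M : Type*} [AddCommMonoid M] (v : Word) (h : Word → M) :
    ∑ u ∈ down (Digit.two :: v), h u =
      h [] + ((∑ u ∈ down v, h (Digit.one :: u)) + ∑ u ∈ down v, h (Digit.two :: u)) := by
  rw [down, Finset.sum_insert (by simp), Finset.sum_union, Finset.sum_image, Finset.sum_image]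
  · intro a _ b _ hab; simpa using hab
  · intro a _ b _ hab; simpa using hab
  · rw [Finset.disjoint_left]
    intro a ha hb
    simp only [Finset.mem_image] at ha hb
    obtain ⟨x, -, rfl⟩ := ha
    obtain ⟨y, -, h⟩ := hb
    simp at h

theorem sum_down_D_zero (w v : Word) : ∑ u ∈ down v, (if w = u then 1 else 0) = D w v 1 := by
  simp only [D_succ, D_zero]

/-- Classify the last word but one: it is ε, 1u or 2u with u ≤ v. After the sums are exchanged, the
sum over u merely adds one edge to the chains ending at v. -/
theorem D_two_nil (v : Word) (n : ℕ) :
    D [] (Digit.two :: v) n = ∑ m ∈ Finset.range n, (m + 1) * D [] v (m + 1) := by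
  induction n generalizing v with
  | zero => simp [D_zero]
  | succ n ih =>
    rw [D_succ, sum_down_two]
    simp only [ih, D_one_cons, reduceCtorEq, if_false, zero_add]
    rw [Finset.sum_comm, Finset.sum_comm (s := down v)]
    simp only [← Finset.mul_sum, ← D_succ]
    rw [Finset.sum_range_succ', D_self, ← Finset.sum_add_distrib]
    -- The contribution of the penultimate word ε is the summand m = 0 of the right-hand side.
    have h1 : D [] v (0 + 1) = 1 := by rw [zero_add, D_one, if_pos (below_nil v)]
    rw [h1, add_comm]
    congr 1
    refine Finset.sum_congr rfl fun m _ => by ring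

/-- Same classification. The word ε contributes nothing, and the case 1u = 1w of `D_one_cons` sums
to the term D(w,v,1), which starts the second sum. -/
theorem D_two_one (w v : Word) (n : ℕ) :
    D (Digit.one :: w) (Digit.two :: v) n =
      ∑ m ∈ Finset.range n, (m * D (Digit.one :: w) v (m + 1) + D w v (m + 1)) := by
  induction n generalizing v with
  | zero => simp [D_zero]
  | succ n ih =>
    rw [D_succ, sum_down_two]
    simp only [ih, D_one_cons, List.cons.injEq, true_and, Finset.sum_add_distrib]
    rw [Finset.sum_comm, Finset.sum_comm (s := down v), Finset.sum_comm (s := down v)]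
    simp only [← Finset.mul_sum, ← D_succ, sum_down_D_zero]
    rw [Finset.sum_range_succ', Finset.sum_range_succ', D_eq_zero (by simp [below_nil_right])]
    simp only [add_mul, Finset.sum_add_distrib]
    simp only [zero_add, zero_mul, one_mul, add_zero]
    ring

/-- Same classification. Here the words 2u carry the term D(w,u,n), whose sum over u is a single
count and not a partial sum. -/
theorem D_two_two (w v : Word) (n : ℕ) :
    D (Digit.two :: w) (Digit.two :: v) n =
      (∑ m ∈ Finset.range n, m * D (Digit.two :: w) v (m + 1)) + D w v n := by
  induction n generalizing v with
  | zero => simp [D_zero]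
  | succ n ih =>
    rw [D_succ, sum_down_two]
    simp only [ih, D_one_cons, List.cons.injEq, reduceCtorEq, false_and, if_false, Finset.sum_add_distrib]
    rw [Finset.sum_comm, Finset.sum_comm (s := down v)]
    simp only [← Finset.mul_sum, ← D_succ]
    rw [Finset.sum_range_succ', D_eq_zero (by simp [below_nil_right])]
    simp only [add_mul, Finset.sum_add_distrib]
    simp only [Finset.sum_const_zero, zero_add, zero_mul, one_mul, add_zero]
    ring

/-! ### Generating functions and the polynomials Q -/

/-- The number of chains, with the value `0` for `n = 0`. -/
noncomputable def cnt (w v : Word) (n : ℕ) : ℝ := if n = 0 then 0 else D w v n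

/-- Partial sums `g 1 + … + g n`. -/
def psum (g : ℕ → ℝ) (n : ℕ) : ℝ := ∑ m ∈ Finset.range n, g (m + 1)

@[simp] theorem cnt_zero (w v : Word) : cnt w v 0 = 0 := rfl

theorem cnt_succ (w v : Word) (n : ℕ) : cnt w v (n + 1) = D w v (n + 1) := rfl

theorem cnt_of_ne {n : ℕ} (w v : Word) (hn : n ≠ 0) : cnt w v n = D w v n := if_neg hn

theorem cnt_nonneg (w v : Word) (n : ℕ) : 0 ≤ cnt w v n := by
  unfold cnt; split_ifs <;> positivity

theorem cnt_le_root (w v : Word) (n : ℕ) : cnt w v n ≤ cnt [] v n := by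
  unfold cnt
  split_ifs with h
  · exact le_rfl
  · exact_mod_cast D_le_root w v h

theorem cnt_eq_zero {w v : Word} (h : ¬ Below w v) (n : ℕ) : cnt w v n = 0 := by
  simp [cnt, D_eq_zero h]

theorem cnt_pos {w v : Word} (h : Below w v) {n : ℕ} (hn : n ≠ 0) : 0 < cnt w v n := by
  rw [cnt_of_ne _ _ hn]; exact_mod_cast D_pos h hn

theorem cnt_self (v : Word) {n : ℕ} (hn : n ≠ 0) : cnt v v n = 1 := by
  simp [cnt, D_self, hn]

theorem cnt_one {w v : Word} (h : w ≠ Digit.one :: v) :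
    cnt w (Digit.one :: v) = psum (cnt w v) := by
  funext n
  cases n with
  | zero => simp [psum]
  | succ n => simp [cnt_succ, psum, D_one_cons, h]

theorem cnt_two_nil (v : Word) :
    cnt [] (Digit.two :: v) = psum fun m => m * cnt [] v m := by
  funext n
  cases n with
  | zero => simp [psum]
  | succ n => simp [cnt_succ, psum, D_two_nil]

theorem cnt_two_one (w v : Word) :
    cnt (Digit.one :: w) (Digit.two :: v) =
      psum fun m => (m - 1) * cnt (Digit.one :: w) v m + cnt w v m := by
  funext n
  cases n with
  | zero => simp [psum]
  | succ n => simp [cnt_succ, psum, D_two_one]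

theorem cnt_two_two (w v : Word) :
    cnt (Digit.two :: w) (Digit.two :: v) =
      psum (fun m => (m - 1) * cnt (Digit.two :: w) v m) + cnt w v := by
  funext n
  cases n with
  | zero => simp [psum]
  | succ n => simp [cnt_succ, psum, D_two_two]

/-- The generating function of the numbers of nonempty chains. -/
noncomputable def gen (w v : Word) : ℝ⟦X⟧ := PowerSeries.mk (cnt w v)

theorem one_sub_X_mul_mk_psum {g : ℕ → ℝ} (hg : g 0 = 0) :
    (1 - PowerSeries.X : ℝ⟦X⟧) * PowerSeries.mk (psum g) = PowerSeries.mk g := by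
  ext n
  rw [sub_mul, one_mul, map_sub, PowerSeries.coeff_mk, PowerSeries.coeff_mk]
  cases n with
  | zero => simp [psum, hg]
  | succ n =>
    rw [mul_comm, PowerSeries.coeff_succ_mul_X, PowerSeries.coeff_mk]
    simp [psum, Finset.sum_range_succ]

theorem mk_nat_mul (g : ℕ → ℝ) :
    PowerSeries.mk (fun m => (m : ℝ) * g m) =
      PowerSeries.X * PowerSeries.derivative ℝ (PowerSeries.mk g) := by
  ext n
  rw [PowerSeries.coeff_mk]
  cases n with
  | zero => simp
  | succ n =>
    rw [mul_comm PowerSeries.X, PowerSeries.coeff_succ_mul_X, PowerSeries.coeff_derivative,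
      PowerSeries.coeff_mk]
    push_cast; ring

theorem gen_one {w v : Word} (h : w ≠ Digit.one :: v) :
    (1 - PowerSeries.X) * gen w (Digit.one :: v) = gen w v := by
  rw [gen, cnt_one h, one_sub_X_mul_mk_psum (cnt_zero _ _), gen]

theorem gen_self (v : Word) : (1 - PowerSeries.X) * gen v v = PowerSeries.X := by
  have : cnt v v = psum fun m => if m = 1 then 1 else 0 := by
    funext n
    cases n with
    | zero => simp [psum]
    | succ n => rw [cnt_self _ n.succ_ne_zero]; simp [psum]
  rw [gen, this, one_sub_X_mul_mk_psum (by simp)]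
  ext n
  simp [PowerSeries.coeff_X]

theorem gen_two_nil (v : Word) :
    (1 - PowerSeries.X) * gen [] (Digit.two :: v) =
      PowerSeries.X * PowerSeries.derivative ℝ (gen [] v) := by
  rw [gen, cnt_two_nil, one_sub_X_mul_mk_psum (by simp), mk_nat_mul, gen]

theorem gen_two_one (w v : Word) :
    (1 - PowerSeries.X) * gen (Digit.one :: w) (Digit.two :: v) =
      PowerSeries.X * PowerSeries.derivative ℝ (gen (Digit.one :: w) v)
        - gen (Digit.one :: w) v + gen w v := by
  rw [gen, cnt_two_one, one_sub_X_mul_mk_psum (by simp), gen, ← mk_nat_mul, gen]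
  ext n
  simp only [map_add, map_sub, PowerSeries.coeff_mk]
  ring

theorem gen_two_two (w v : Word) :
    (1 - PowerSeries.X) * gen (Digit.two :: w) (Digit.two :: v) =
      PowerSeries.X * PowerSeries.derivative ℝ (gen (Digit.two :: w) v)
        - gen (Digit.two :: w) v + (1 - PowerSeries.X) * gen w v := by
  have : gen (Digit.two :: w) (Digit.two :: v) =
      PowerSeries.mk (psum fun m => (m - 1) * cnt (Digit.two :: w) v m) + gen w v := by
    rw [gen, cnt_two_two, gen]
    rfl
  rw [this, mul_add, one_sub_X_mul_mk_psum (by simp), gen, gen, ← mk_nat_mul]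
  congr 1
  ext n
  simp only [map_sub, PowerSeries.coeff_mk]
  ring

theorem gen_eq_zero {w v : Word} (h : ¬ Below w v) : gen w v = 0 := by
  ext n
  simp [gen, cnt_eq_zero h]

theorem one_sub_X_mul_derivative_pow (k : ℕ) :
    (1 - PowerSeries.X) * PowerSeries.derivative ℝ ((1 - PowerSeries.X) ^ k) =
      -(k : ℝ⟦X⟧) * (1 - PowerSeries.X) ^ k := by
  rw [PowerSeries.derivative_pow, map_sub, PowerSeries.derivative_X, PowerSeries.derivative_one]
  cases k with
  | zero => simp
  | succ k => rw [pow_succ, Nat.add_sub_cancel]; ring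

/-- The effect of the Euler operator on a power series with a pole at `1`. -/
theorem pole_derivative {F Q : ℝ⟦X⟧} {n k : ℕ}
    (h : (1 - PowerSeries.X) ^ n * F = (1 - PowerSeries.X) ^ k * Q) :
    (1 - PowerSeries.X) ^ (n + 1) * PowerSeries.derivative ℝ F =
      (1 - PowerSeries.X) ^ k * ((1 - PowerSeries.X) * PowerSeries.derivative ℝ Q
        + ((n : ℝ⟦X⟧) - (k : ℝ⟦X⟧)) * Q) := by
  have h1 := congrArg (PowerSeries.derivative ℝ) h
  rw [Derivation.leibniz, Derivation.leibniz] at h1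
  simp only [smul_eq_mul] at h1
  have hn := one_sub_X_mul_derivative_pow n
  have hk := one_sub_X_mul_derivative_pow k
  linear_combination (1 - PowerSeries.X) * h1 - F * hn + Q * hk + (n : ℝ⟦X⟧) * h

/-- The leading two adds one to the available twos. If the inequality fails without it, it is an
equality with it. -/
theorem tight_of_below_two {a : Digit} {w v : Word} (h : Below (a :: w) (Digit.two :: v))
    (h' : ¬ Below (a :: w) v) : Tight (a :: w) (Digit.two :: v) := by
  rw [below_iff_rev, List.reverse_cons (a := Digit.two)] at h
  rw [below_iff_rev] at h'
  rw [tight_iff_rev, List.reverse_cons (a := Digit.two)]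
  generalize (a :: w).reverse = A at *
  generalize v.reverse = B at *
  clear a w v
  induction A generalizing B with
  | nil => exact (h' (by simp [BelowRev, stripPrefix])).elim
  | cons c A ih =>
    cases B with
    | nil => cases c <;> cases A <;> simp_all [BelowRev, TightRev, stripPrefix]
    | cons e B =>
      by_cases h1 : c = e
      · subst h1
        have := ih B (by simpa [BelowRev, stripPrefix] using h)
          (by simpa [BelowRev, stripPrefix] using h')
        simpa [TightRev, stripPrefix] using this
      · have h2 : ¬ e = c := fun q => h1 q.symm
        simp only [TightRev, BelowRev, List.cons_append, stripPrefix, if_neg h1, if_neg h2,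
          List.length_cons] at h h' ⊢
        rw [← List.cons_append, twos_append] at h ⊢
        simp at h h' ⊢
        omega

/-- Below a leading two, tightness removes the chains from aw to v, so only the term for (w,v)
survives in the recursion. Hence the numerator stays constant, matching the value 1 prescribed for
Q. -/
theorem gen_of_tight {w v : Word} (h : Tight w v) :
    (1 - PowerSeries.X) ^ (weight v + 1) * gen w v =
      (1 - PowerSeries.X) ^ weight w * PowerSeries.X := by
  induction v generalizing w with
  | nil =>
    cases w with
    | nil => simpa [weight] using gen_self []
    | cons a w => exact (not_tight_nil_right h).elim
  | cons b v ih =>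
    cases b
    · by_cases hw : w = Digit.one :: v
      · subst hw
        rw [pow_succ, mul_assoc, gen_self]
      · rw [weight, pow_succ, mul_assoc, gen_one hw]
        exact ih ((tight_one.1 h).resolve_left hw)
    · cases w with
      | nil => simp [tight_nil] at h
      | cons a w =>
        obtain ⟨h1, h2⟩ := h.of_two
        have ih := ih h1
        have h0 := gen_eq_zero h2
        cases a
        · have := gen_two_one w v
          rw [h0, map_zero] at this
          simp only [weight]
          linear_combination (1 - PowerSeries.X) ^ (weight v + 2) * this
            + (1 - PowerSeries.X) * ih
        · have := gen_two_two w v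
          rw [h0, map_zero] at this
          simp only [weight]
          linear_combination (1 - PowerSeries.X) ^ (weight v + 2) * this
            + (1 - PowerSeries.X) ^ 2 * ih

/-- Induction on v. A leading one divides by 1-X. A leading two applies the Euler operator, which
raises the order of the pole by one, and then divides by 1-X; `pole_derivative` turns this into the
differential recursion of Q. -/
theorem gen_eq {w v : Word} (h : Below w v) :
    (1 - PowerSeries.X) ^ (weight v + 1) * gen w v =
      (1 - PowerSeries.X) ^ weight w * (PowerSeries.X * (Q w v : ℝ⟦X⟧)) := by
  induction v generalizing w with
  | nil =>
    rw [below_nil_right] at h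
    subst h
    simpa [Q, Qroot, weight] using gen_self []
  | cons b v ih =>
    cases w with
    | nil =>
      have ih := ih (below_nil v)
      cases b
      · rw [weight, pow_succ, mul_assoc, gen_one (by simp)]
        simpa [Q, Qroot, weight] using ih
      · have h1 := pole_derivative ih
        have h2 := gen_two_nil v
        have hQ : Q [] (Digit.two :: v) = (1 - X) * (Q [] v + X * derivative (Q [] v))
            + C ((weight v : ℝ) + 1) * X * Q [] v := by
          simp [Q, Qroot]
        rw [hQ]
        rw [Derivation.leibniz, PowerSeries.derivative_X, PowerSeries.derivative_coe] at h1
        simp only [smul_eq_mul] at h1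
        push_cast at h1 ⊢
        simp only [weight] at h1 ⊢
        simp only [map_add, map_natCast, map_one]
        linear_combination (1 - PowerSeries.X) ^ (weight v + 2) * h2 + PowerSeries.X * h1
    | cons a w =>
      by_cases ht : Tight (a :: w) (b :: v)
      · have hQ : Q (a :: w) (b :: v) = 1 := by
          cases b
          · rw [Q]; exact if_pos ht
          · rw [Q]; exact if_pos ht
        rw [hQ, Polynomial.coe_one, mul_one]
        exact gen_of_tight ht
      · cases b
        · rw [Q, if_neg (show ¬ twos _ = _ from ht)]
          have hne : a :: w ≠ Digit.one :: v := fun h => ht (tight_one.2 (Or.inl h))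
          rw [weight, pow_succ, mul_assoc, gen_one hne]
          exact ih ((below_one.1 h).resolve_left hne)
        · rw [Q, if_neg (show ¬ twos _ = _ from ht)]
          -- Outside the tight case both polynomials in the recursion belong to comparable pairs, so
          -- both induction hypotheses are available.
          have hb : Below (a :: w) v := by
            by_contra hb
            exact ht (tight_of_below_two h hb)
          have ih1 := ih hb
          have ih2 := ih (below_two.1 h)
          have h1 := pole_derivative ih1
          rw [Derivation.leibniz, PowerSeries.derivative_X, PowerSeries.derivative_coe] at h1
          simp only [smul_eq_mul] at h1
          push_cast at h1 ⊢
          simp only [map_add, map_sub, map_natCast, map_one]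
          cases a
          · have h2 := gen_two_one w v
            simp only [weight] at h1 h2 ih1 ih2 ⊢
            push_cast at h1 ⊢
            linear_combination (1 - PowerSeries.X) ^ (weight v + 2) * h2 + PowerSeries.X * h1
              - (1 - PowerSeries.X) * ih1 + (1 - PowerSeries.X) * ih2
          · have h2 := gen_two_two w v
            simp only [weight] at h1 h2 ih1 ih2 ⊢
            push_cast at h1 ⊢
            linear_combination (1 - PowerSeries.X) ^ (weight v + 2) * h2 + PowerSeries.X * h1
              - (1 - PowerSeries.X) * ih1 + (1 - PowerSeries.X) ^ 2 * ih2

/-! ### Words with a long block of ones -/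

@[simp] theorem weight_replicate_append (N : ℕ) (v : Word) :
    weight (List.replicate N Digit.one ++ v) = N + weight v := by
  induction N with
  | zero => simp
  | succ N ih => rw [List.replicate_succ, List.cons_append, weight, ih]; ring

theorem replicate_append_inj {M N : ℕ} {v : Word}
    (h : List.replicate M Digit.one ++ v = List.replicate N Digit.one ++ v) : M = N := by
  have := congrArg weight h
  simpa using this

theorem below_replicate {w v : Word} {N : ℕ} :
    Below w (List.replicate N Digit.one ++ v) ↔
      Below w v ∨ ∃ W, 1 ≤ W ∧ W ≤ N ∧ w = List.replicate W Digit.one ++ v := by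
  induction N with
  | zero => simp
  | succ N ih =>
    rw [List.replicate_succ, List.cons_append, below_one, ih]
    constructor
    · rintro (h | h | ⟨W, h1, h2, h3⟩)
      · exact Or.inr ⟨N + 1, by omega, le_rfl, h⟩
      · exact Or.inl h
      · exact Or.inr ⟨W, h1, by omega, h3⟩
    · rintro (h | ⟨W, h1, h2, h3⟩)
      · exact Or.inr (Or.inl h)
      · rcases h2.lt_or_eq with h2 | rfl
        · exact Or.inr (Or.inr ⟨W, h1, by omega, h3⟩)
        · exact Or.inl h3

theorem tight_replicate (w : Word) (N : ℕ) : Tight w (List.replicate N Digit.one ++ w) := by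
  induction N with
  | zero =>
    induction w with
    | nil => simp [tight_nil]
    | cons a w ih =>
      have : ∀ v : Word, strip v v = [] := by
        intro v
        unfold strip
        induction v.reverse with
        | nil => rfl
        | cons a v ih => simpa [stripPrefix] using ih
      simp [Tight, this]
  | succ N ih => exact tight_one.2 (Or.inr ih)

open Classical in
/-- The numerator of the limit of the ratios of chain counts for words ending in `1 … 1 v`. -/
noncomputable def limitPoly (v w : Word) : ℝ[X] :=
  if Below w v then (1 - X) ^ weight w * Q w v
  else if ∃ W : ℕ, 1 ≤ W ∧ w = List.replicate W Digit.one ++ v then (1 - X) ^ weight w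
  else 0

theorem limitPoly_nil (v : Word) : limitPoly v [] = Q [] v := by
  rw [limitPoly, if_pos (below_nil v)]
  simp [weight]

theorem gen_replicate (M : ℕ) :
    (1 - PowerSeries.X) ^ (M + 1) * gen [] (List.replicate M Digit.one) = PowerSeries.X := by
  have := gen_of_tight (tight_replicate [] M)
  have hM : weight (List.replicate M Digit.one) = M := by
    simpa [weight] using weight_replicate_append M []
  simpa [hM, weight] using this

theorem one_sub_X_pow_mul_gen {w v : Word} (h : Below w v) (N : ℕ) :
    (1 - PowerSeries.X) ^ N * gen w (List.replicate N Digit.one ++ v) = gen w v := by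
  induction N with
  | zero => simp
  | succ N ih =>
    rw [List.replicate_succ, List.cons_append, pow_succ, mul_assoc, gen_one, ih]
    intro h'
    have := h.weight_le
    rw [h', weight, weight_replicate_append] at this
    omega

/-- The words 1^Nv and 1^(N+|v|) have the same weight, hence the same denominator, and the numerator
for the second word and ε is just X. The lower bound on N makes the block long enough for every w =
1^Wv. -/
theorem gen_replicate_append {w v : Word} {N : ℕ} (hN : w.length ≤ N) :
    gen w (List.replicate N Digit.one ++ v) =
      (limitPoly v w : ℝ⟦X⟧) * gen [] (List.replicate (N + weight v) Digit.one) := by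
  have h0 : (1 - PowerSeries.X : ℝ⟦X⟧) ≠ 0 := by
    intro h
    have := congrArg (PowerSeries.coeff 0) h
    simp at this
  refine mul_left_cancel₀ (pow_ne_zero (N + weight v + 1) h0) ?_
  rw [mul_left_comm, gen_replicate]
  unfold limitPoly
  split_ifs with h1 h2
  · rw [add_assoc, pow_add, mul_right_comm, one_sub_X_pow_mul_gen h1, mul_comm, gen_eq h1]
    push_cast
    ring
  · obtain ⟨W, hW, hw⟩ := h2
    have hWN : W ≤ N := by
      have := congrArg List.length hw
      simp at this
      omega
    obtain ⟨k, rfl⟩ := Nat.exists_eq_add_of_le' hWN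
    -- The larger word is w preceded by ones, so the pair is tight and the numerator has no factor
    -- Q.
    have h3 : List.replicate (k + W) Digit.one ++ v = List.replicate k Digit.one ++ w := by
      rw [hw, ← List.append_assoc, List.replicate_append_replicate]
    have := gen_of_tight (tight_replicate w k)
    have hwt : weight w = W + weight v := by rw [hw, weight_replicate_append]
    rw [weight_replicate_append] at this
    rw [h3, show k + W + weight v + 1 = k + weight w + 1 by omega, this]
    push_cast
    rfl
  · rw [gen_eq_zero]
    · simp
    · rw [below_replicate]
      rintro (h | ⟨W, hW, -, h⟩)
      · exact h1 h
      · exact h2 ⟨W, hW, h⟩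

/-! ### Positivity and harmonicity -/

open Classical in
-- A nonempty chain is a single edge, or a first edge w ≤ u followed by a nonempty chain from u.
theorem gen_eq_sum {w v : Word} (h : Below w v) :
    gen w v = PowerSeries.X + PowerSeries.X * ∑ u ∈ (down v).filter (Below w), gen u v := by
  ext n
  rw [map_add]
  cases n with
  | zero => simp [gen]
  | succ n =>
    rw [mul_comm, PowerSeries.coeff_succ_mul_X, map_sum]
    simp only [gen, PowerSeries.coeff_mk, PowerSeries.coeff_X]
    cases n with
    | zero => simp [cnt_succ, D_one, h]
    | succ n =>
      rw [cnt_succ, add_comm (n + 1) 1, D_add, Finset.sum_filter]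
      simp [cnt_succ, D_one]

open Classical in
theorem poly_eq_sum {w v : Word} (h : Below w v) :
    (1 - X) ^ weight w * Q w v = (1 - X) ^ (weight v + 1) +
      X * ∑ u ∈ (down v).filter (Below w), (1 - X) ^ weight u * Q u v := by
  apply Polynomial.coe_injective
  refine mul_left_cancel₀ (PowerSeries.X_ne_zero (R := ℝ)) ?_
  have h1 : (1 - PowerSeries.X) ^ (weight v + 1) * gen w v = _ := congrArg _ (gen_eq_sum h)
  have h2 : (1 - PowerSeries.X) ^ (weight v + 1) * ∑ u ∈ (down v).filter (Below w), gen u v =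
      PowerSeries.X * ∑ u ∈ (down v).filter (Below w),
        (1 - PowerSeries.X) ^ weight u * (Q u v : ℝ⟦X⟧) := by
    rw [Finset.mul_sum, Finset.mul_sum]
    refine Finset.sum_congr rfl fun u hu => ?_
    rw [gen_eq (mem_down.1 (Finset.mem_filter.1 hu).1)]
    ring
  rw [gen_eq h] at h1
  rw [← Polynomial.coeToPowerSeries.ringHom_apply, ← Polynomial.coeToPowerSeries.ringHom_apply]
  simp only [map_mul, map_add, map_pow, map_sub, map_one, map_sum,
    Polynomial.coeToPowerSeries.ringHom_apply, Polynomial.coe_X]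
  linear_combination h1 + PowerSeries.X * h2

/-- In `poly_eq_sum` move the term u = w to the left. Its coefficient becomes 1-p > 0, and the other
terms belong to words of larger weight, so induction on |v|-|w| applies. -/
theorem poly_pos {p : ℝ} (hp : p ∈ Set.Ioo (0 : ℝ) 1) {w v : Word} (h : Below w v) :
    0 < ((1 - X) ^ weight w * Q w v).eval p := by
  classical
  obtain ⟨n, hn⟩ : ∃ n, weight v - weight w = n := ⟨_, rfl⟩
  induction n using Nat.strong_induction_on generalizing w with
  | _ n ih =>
    have h1 := congrArg (Polynomial.eval p) (poly_eq_sum h)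
    rw [eval_add, eval_mul (p := X), eval_X, eval_finsetSum] at h1
    have hmem : w ∈ (down v).filter (Below w) :=
      Finset.mem_filter.2 ⟨mem_down.2 h, Below.refl w⟩
    rw [← Finset.add_sum_erase _ _ hmem] at h1
    have h2 : 0 ≤ ∑ u ∈ ((down v).filter (Below w)).erase w,
        ((1 - X) ^ weight u * Q u v).eval p := by
      refine Finset.sum_nonneg fun u hu => ?_
      rw [Finset.mem_erase, Finset.mem_filter, mem_down] at hu
      refine (ih _ ?_ hu.2.1 rfl).le
      have h3 : weight w < weight u := by
        by_contra hlt
        exact hu.1 (hu.2.2.eq_of_weight (not_lt.1 hlt)).symm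
      have := hu.2.1.weight_le
      omega
    have h4 : 0 < ((1 - X : ℝ[X]) ^ (weight v + 1)).eval p := by
      simpa using pow_pos (sub_pos.2 hp.2) _
    have hp0 := hp.1
    have hp1 := sub_pos.2 hp.2
    refine pos_of_mul_pos_right (a := 1 - p) ?_ hp1.le
    rw [sub_mul, one_mul]
    nlinarith [mul_nonneg hp0.le h2]

theorem Q_pos {p : ℝ} (hp : p ∈ Set.Ioo (0 : ℝ) 1) {w v : Word} (h : Below w v) :
    0 < (Q w v).eval p := by
  have := poly_pos hp h
  rw [eval_mul] at this
  refine pos_of_mul_pos_right this ?_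
  simpa using pow_nonneg (sub_pos.2 hp.2).le _

/-- The limit of the ratios of chain counts for words ending in `1 … 1 v`. -/
noncomputable def psi (v : Word) (p : ℝ) (w : Word) : ℝ :=
  (limitPoly v w).eval p / (Q [] v).eval p

theorem mu_eq {K : ℕ} (v : Word) (p : ℝ) (x : Vertex K) :
    mu v p x = (D [] x.word x.level : ℝ) * p ^ x.level * psi v p x.word := by
  unfold mu psi limitPoly
  split_ifs <;> simp <;> ring

theorem psi_nonneg {p : ℝ} (hp : p ∈ Set.Ioo (0 : ℝ) 1) (v w : Word) : 0 ≤ psi v p w := by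
  refine div_nonneg ?_ (Q_pos hp (below_nil v)).le
  unfold limitPoly
  split_ifs with h1 h2
  · exact (poly_pos hp h1).le
  · simpa using pow_nonneg (sub_pos.2 hp.2).le _
  · simp

theorem psi_nil {p : ℝ} (hp : p ∈ Set.Ioo (0 : ℝ) 1) (v : Word) : psi v p [] = 1 := by
  rw [psi, limitPoly_nil, div_self (Q_pos hp (below_nil v)).ne']

theorem psi_ne_zero {p : ℝ} (hp : p ∈ Set.Ioo (0 : ℝ) 1) {v w : Word} :
    psi v p w ≠ 0 ↔
      Below w v ∨ ∃ W : ℕ, 1 ≤ W ∧ w = List.replicate W Digit.one ++ v := by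
  have h0 := (Q_pos hp (below_nil v)).ne'
  unfold psi limitPoly
  split_ifs with h1 h2
  · simpa [h1, h0] using (poly_pos hp h1).ne'
  · simp only [h1, h2, or_true, iff_true]
    refine div_ne_zero ?_ h0
    simpa using pow_ne_zero _ (sub_pos.2 hp.2).ne'
  · simp only [h1, h2, or_self, iff_false]
    simp

theorem hasSum_replicate {p : ℝ} (hp : p ∈ Set.Ioo (0 : ℝ) 1) (v : Word) :
    HasSum (fun W : ℕ => (1 - p) ^ weight (List.replicate W Digit.one ++ v))
      ((1 - p) ^ weight v / p) := by
  simp only [weight_replicate_append, pow_add]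
  have := (hasSum_geometric_of_lt_one (sub_pos.2 hp.2).le (by linarith [hp.1] : 1 - p < 1)).mul_right
    ((1 - p) ^ weight v)
  rwa [sub_sub_cancel, inv_mul_eq_div] at this

open Classical in
-- For w ≤ v the words 1^Wv with W ≥ 1 contribute the geometric sum (1-p)^(|v|+1)/p, which is
-- exactly the term of `poly_eq_sum` not accounted for by the words up to v. For w = 1^Wv only the
-- geometric series remains.
theorem hasSum_limitPoly {p : ℝ} (hp : p ∈ Set.Ioo (0 : ℝ) 1) (v w : Word) :
    HasSum (fun u => if Below w u then (limitPoly v u).eval p else 0)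
      ((limitPoly v w).eval p / p) := by
  have hp0 := hp.1.ne'
  have hinj : ∀ z : Word, Function.Injective fun W : ℕ => List.replicate W Digit.one ++ z :=
    fun z M N h => replicate_append_inj h
  have htail : ∀ z W, 1 ≤ weight z → z = List.replicate W Digit.one ++ v → 1 ≤ W →
      (limitPoly v z).eval p = (1 - p) ^ weight z := by
    intro z W hz hzv hW
    rw [limitPoly, if_neg, if_pos ⟨W, hW, hzv⟩]
    · simp
    · intro h
      have := h.weight_le
      rw [hzv, weight_replicate_append] at this
      omega
  by_cases h1 : Below w v
  -- The support splits into the finitely many words between w and v and the words 1^W1v, all of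
  -- which lie above w.
  · have hsplit : (fun u => if Below w u then (limitPoly v u).eval p else 0) =
        fun u => (if u ∈ (down v).filter (Below w) then ((1 - X) ^ weight u * Q u v).eval p else 0)
          + if (∃ W : ℕ, u = List.replicate W Digit.one ++ (Digit.one :: v))
            then (1 - p) ^ weight u else 0 := by
      funext u
      by_cases hu : Below u v
      · have hno : ¬ ∃ W : ℕ, u = List.replicate W Digit.one ++ (Digit.one :: v) := by
          rintro ⟨W, rfl⟩
          have := hu.weight_le
          rw [weight_replicate_append, weight] at this
          omega
        rw [if_neg hno, add_zero, limitPoly, if_pos hu]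
        simp [mem_down, hu]
      · have hno : u ∉ (down v).filter (Below w) := fun h =>
          hu (mem_down.1 (Finset.mem_filter.1 h).1)
        have hiff : (∃ W : ℕ, 1 ≤ W ∧ u = List.replicate W Digit.one ++ v) ↔
            ∃ W : ℕ, u = List.replicate W Digit.one ++ (Digit.one :: v) := by
          constructor
          · rintro ⟨W, hW, rfl⟩
            obtain ⟨W, rfl⟩ := Nat.exists_eq_add_of_le' hW
            exact ⟨W, by simp [List.replicate_succ']⟩
          · rintro ⟨W, rfl⟩
            exact ⟨W + 1, by omega, by simp [List.replicate_succ']⟩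
        rw [if_neg hno, zero_add, limitPoly, if_neg hu]
        simp only [hiff]
        by_cases hW : ∃ W : ℕ, u = List.replicate W Digit.one ++ (Digit.one :: v)
        · rw [if_pos hW, if_pos hW, if_pos]
          · simp
          · obtain ⟨W, rfl⟩ := hW
            exact (h1.cons _).append _
        · simp [hW]
    have ha : HasSum (fun u => if u ∈ (down v).filter (Below w) then
        ((1 - X) ^ weight u * Q u v).eval p else 0)
        (∑ u ∈ (down v).filter (Below w), ((1 - X) ^ weight u * Q u v).eval p) := by
      rw [Finset.sum_congr rfl fun u hu => (if_pos hu).symm]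
      exact hasSum_sum_of_ne_finset_zero fun u hu => if_neg hu
    have hb : HasSum (fun u : Word =>
        if (∃ W : ℕ, u = List.replicate W Digit.one ++ (Digit.one :: v))
          then (1 - p) ^ weight u else 0) ((1 - p) ^ weight (Digit.one :: v) / p) := by
      rw [← (hinj (Digit.one :: v)).hasSum_iff]
      · convert hasSum_replicate hp (Digit.one :: v) using 2 with W
        exact if_pos ⟨W, rfl⟩
      · intro u hu
        exact if_neg fun ⟨W, hW⟩ => hu ⟨W, hW.symm⟩
    rw [hsplit]
    convert ha.add hb using 1
    have := congrArg (Polynomial.eval p) (poly_eq_sum h1)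
    rw [eval_add, eval_mul (p := X), eval_X, eval_finsetSum] at this
    rw [limitPoly, if_pos h1, this]
    simp only [eval_pow, eval_sub, eval_one, eval_X, weight]
    field_simp
    ring
  · by_cases h2 : ∃ W : ℕ, 1 ≤ W ∧ w = List.replicate W Digit.one ++ v
    · obtain ⟨W0, hW0, hw⟩ := h2
      have hwt : 1 ≤ weight w := by rw [hw, weight_replicate_append]; omega
      rw [htail w W0 hwt hw hW0, ← (hinj w).hasSum_iff]
      · convert hasSum_replicate hp w using 2 with W
        rw [Function.comp_apply, if_pos ((Below.refl w).append _)]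
        refine htail _ (W + W0) (by rw [weight_replicate_append]; omega) ?_ (by omega)
        rw [hw, ← List.append_assoc, List.replicate_append_replicate]
      · intro u hu
        rw [ite_eq_right_iff]
        intro hwu
        rw [limitPoly, if_neg, if_neg]
        · simp
        · rintro ⟨W, hW, rfl⟩
          apply hu
          have := hwu.weight_le
          rw [hw, weight_replicate_append, weight_replicate_append] at this
          obtain ⟨k, rfl⟩ := Nat.exists_eq_add_of_le' (Nat.le_of_add_le_add_right this)
          exact ⟨k, by
            simp only [hw]; rw [← List.append_assoc, List.replicate_append_replicate]⟩
        · exact fun h => h1 (hwu.trans h)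
    · have : (fun u => if Below w u then (limitPoly v u).eval p else 0) = fun _ => 0 := by
        funext u
        rw [ite_eq_right_iff]
        intro hwu
        rw [limitPoly, if_neg, if_neg]
        · simp
        · rintro ⟨W, hW, rfl⟩
          rcases below_replicate.1 hwu with h | ⟨W', hW', -, h⟩
          · exact h1 h
          · exact h2 ⟨W', hW', h⟩
        · exact fun h => h1 (hwu.trans h)
      rw [this, limitPoly, if_neg h1, if_neg h2]
      simp

open Classical in
theorem hasSum_psi {p : ℝ} (hp : p ∈ Set.Ioo (0 : ℝ) 1) (v w : Word) :
    HasSum (fun u => if Below w u then p * psi v p u else 0) (psi v p w) := by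
  have := ((hasSum_limitPoly hp v w).mul_left p).div_const ((Q [] v).eval p)
  rw [mul_div_cancel₀ _ hp.1.ne'] at this
  have h : (fun u => if Below w u then p * psi v p u else 0) = fun u =>
      p * (if Below w u then (limitPoly v u).eval p else 0) / (Q [] v).eval p := by
    funext u
    simp only [psi]
    split_ifs <;> ring
  rw [h]
  exact this

/-! ### Prefixes as operators on sequences -/

/-- `psum` as a linear map. -/
def psumL : (ℕ → ℝ) →ₗ[ℝ] (ℕ → ℝ) where
  toFun := psum
  map_add' f g := by funext n; simp [psum, Finset.sum_add_distrib]
  map_smul' c f := by funext n; simp [psum, Finset.mul_sum]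

/-- The Euler operator on sequences. -/
def eulerL : (ℕ → ℝ) →ₗ[ℝ] (ℕ → ℝ) where
  toFun g m := m * g m
  map_add' f g := by funext n; simp [mul_add]
  map_smul' c f := by funext n; simp [mul_left_comm]

/-- The shift of a sequence by one place to the right. -/
def shiftL : (ℕ → ℝ) →ₗ[ℝ] (ℕ → ℝ) where
  toFun g n := if n = 0 then 0 else g (n - 1)
  map_add' f g := by funext n; by_cases h : n = 0 <;> simp [h]
  map_smul' c f := by funext n; by_cases h : n = 0 <;> simp [h]

/-- The operator on sequences by which the prefix `x` acts on numbers of chains. -/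
def prefixL : Word → ((ℕ → ℝ) →ₗ[ℝ] (ℕ → ℝ))
  | [] => LinearMap.id
  | Digit.one :: x => psumL ∘ₗ prefixL x
  | Digit.two :: x => psumL ∘ₗ eulerL ∘ₗ prefixL x

/-- The sum of the operators `prefixL` over the words obtained from `x` by replacing a two by
a one. -/
def errL : Word → ((ℕ → ℝ) →ₗ[ℝ] (ℕ → ℝ))
  | [] => 0
  | Digit.one :: x => psumL ∘ₗ errL x
  | Digit.two :: x => psumL ∘ₗ prefixL x + psumL ∘ₗ eulerL ∘ₗ errL x

@[simp] theorem psumL_apply (g : ℕ → ℝ) : psumL g = psum g := rfl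
@[simp] theorem eulerL_apply (g : ℕ → ℝ) (n : ℕ) : eulerL g n = n * g n := rfl
@[simp] theorem shiftL_zero (g : ℕ → ℝ) : shiftL g 0 = 0 := rfl
@[simp] theorem shiftL_succ (g : ℕ → ℝ) (n : ℕ) : shiftL g (n + 1) = g n := rfl
@[simp] theorem psum_zero (g : ℕ → ℝ) : psum g 0 = 0 := rfl

theorem psum_succ (g : ℕ → ℝ) (n : ℕ) : psum g (n + 1) = psum g n + g (n + 1) :=
  Finset.sum_range_succ _ _

theorem psumL_mono : Monotone psumL := fun _ _ h n =>
  Finset.sum_le_sum (s := Finset.range n) fun m _ => h (m + 1)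

theorem eulerL_mono : Monotone eulerL := fun _ _ h n =>
  mul_le_mul_of_nonneg_left (h n) n.cast_nonneg

theorem shiftL_mono : Monotone shiftL := fun f g h n => by
  cases n with
  | zero => exact le_rfl
  | succ n => exact h n

theorem prefixL_mono (x : Word) : Monotone (prefixL x) := by
  induction x with
  | nil => exact monotone_id
  | cons a x ih =>
    cases a
    · exact psumL_mono.comp ih
    · exact psumL_mono.comp (eulerL_mono.comp ih)

theorem errL_mono (x : Word) : Monotone (errL x) := by
  induction x with
  | nil => exact fun _ _ _ => le_rfl
  | cons a x ih =>
    cases a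
    · exact psumL_mono.comp ih
    · exact fun f g h => add_le_add (psumL_mono (prefixL_mono x h))
        (psumL_mono (eulerL_mono (ih h)))

theorem prefixL_append (x y : Word) (g : ℕ → ℝ) :
    prefixL (x ++ y) g = prefixL x (prefixL y g) := by
  induction x with
  | nil => rfl
  | cons a x ih => cases a <;> simp [prefixL, ih]

theorem cnt_nil_append (x y : Word) : cnt [] (x ++ y) = prefixL x (cnt [] y) := by
  induction x with
  | nil => rfl
  | cons a x ih =>
    cases a
    · simp [prefixL, cnt_one, ← ih]
    · simp only [List.cons_append, cnt_two_nil, ih]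
      rfl

/-- Nondecreasing sequences that vanish at `0`. -/
structure Ascending (g : ℕ → ℝ) : Prop where
  zero : g 0 = 0
  mono : Monotone g

theorem Ascending.nonneg {g : ℕ → ℝ} (h : Ascending g) : 0 ≤ g := fun n => by
  simpa [h.zero] using h.mono (Nat.zero_le n)

theorem ascending_psum {g : ℕ → ℝ} (h : 0 ≤ g) : Ascending (psum g) :=
  ⟨rfl, monotone_nat_of_le_succ fun n => by
    rw [psum_succ]; exact le_add_of_nonneg_right (h _)⟩

theorem Ascending.prefixL {g : ℕ → ℝ} (h : Ascending g) (x : Word) :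
    Ascending (prefixL x g) := by
  induction x with
  | nil => exact h
  | cons a x ih =>
    cases a
    · exact ascending_psum ih.nonneg
    · exact ascending_psum fun n => mul_nonneg n.cast_nonneg (ih.nonneg n)

theorem Ascending.shiftL {g : ℕ → ℝ} (h : Ascending g) : Ascending (shiftL g) :=
  ⟨rfl, monotone_nat_of_le_succ fun n => by
    cases n with
    | zero => exact h.nonneg 0
    | succ n => exact h.mono n.le_succ⟩

theorem Ascending.shiftL_le {g : ℕ → ℝ} (h : Ascending g) : JumpYF.shiftL g ≤ g := fun n => by
  cases n with
  | zero => exact h.nonneg 0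
  | succ n => exact h.mono n.le_succ

theorem ascending_cnt_nil (v : Word) : Ascending (cnt [] v) := by
  have : Ascending (cnt [] []) := by
    refine ⟨rfl, monotone_nat_of_le_succ fun n => ?_⟩
    rw [cnt_self _ n.succ_ne_zero]
    unfold cnt
    split_ifs <;> simp [D_self]
  simpa [← cnt_nil_append] using this.prefixL v

theorem psum_shiftL {g : ℕ → ℝ} (h : g 0 = 0) : psum (shiftL g) = shiftL (psum g) := by
  funext n
  induction n with
  | zero => rfl
  | succ n ih =>
    rw [psum_succ, ih, shiftL_succ, shiftL_succ]
    cases n with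
    | zero => simp [h]
    | succ n => rw [shiftL_succ, psum_succ]

theorem eulerL_shiftL (g : ℕ → ℝ) : eulerL (shiftL g) = shiftL (eulerL g) + shiftL g := by
  funext n
  cases n with
  | zero => simp
  | succ n => simp; ring

theorem psum_sub_shiftL {g : ℕ → ℝ} (h : g 0 = 0) : psum g - shiftL (psum g) = g := by
  funext n
  cases n with
  | zero => simp [h]
  | succ n => simp [psum_succ]

/-- Partial sums commute with the shift, and the Euler operator does so up to one extra shifted
copy. Each two of x therefore costs a term in which its Euler operator is missing, i.e. the two has
become a one. -/
theorem shiftL_prefixL_le {g : ℕ → ℝ} (hg : Ascending g) (x : Word) :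
    shiftL (prefixL x g) ≤ prefixL x (shiftL g) ∧
      prefixL x (shiftL g) ≤ shiftL (prefixL x g) + errL x g := by
  induction x with
  | nil => exact ⟨le_rfl, le_of_eq (by simp [prefixL, errL])⟩
  | cons a x ih =>
    obtain ⟨h1, h2⟩ := ih
    have hx := hg.prefixL x
    cases a
    · simp only [prefixL, errL, LinearMap.comp_apply]
      rw [psumL_apply (prefixL x g), ← psum_shiftL hx.zero, ← psumL_apply, ← map_add]
      exact ⟨psumL_mono h1, psumL_mono h2⟩
    · simp only [prefixL, errL, LinearMap.comp_apply, LinearMap.add_apply]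
      have h3 : shiftL (psumL (eulerL (prefixL x g))) =
          psumL (eulerL (shiftL (prefixL x g))) - psumL (shiftL (prefixL x g)) := by
        rw [psumL_apply, ← psum_shiftL (by simp), ← psumL_apply, eulerL_shiftL, map_add]
        simp
      have h4 := psumL_mono (eulerL_mono h1)
      have h5 := psumL_mono (eulerL_mono h2)
      rw [map_add, map_add] at h5
      have h6 := psumL_mono hx.shiftL_le
      have h7 := psumL_mono hx.shiftL.nonneg
      rw [map_zero] at h7
      rw [h3]
      constructor
      · intro n
        have a1 := h4 n
        have a2 := h7 n
        simp only [Pi.sub_apply, Pi.zero_apply] at *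
        linarith
      · intro n
        have a1 := h5 n
        have a2 := h6 n
        simp only [Pi.sub_apply, Pi.add_apply] at *
        linarith

theorem Ascending.iterate {g : ℕ → ℝ} (hg : Ascending g) (j : ℕ) :
    Ascending (JumpYF.shiftL^[j] g) ∧ JumpYF.shiftL^[j] g ≤ g := by
  induction j with
  | zero => exact ⟨hg, le_rfl⟩
  | succ j ih =>
    rw [Function.iterate_succ_apply']
    exact ⟨ih.1.shiftL, ih.1.shiftL_le.trans ih.2⟩

theorem iterate_shiftL_prefixL {g : ℕ → ℝ} (hg : Ascending g) (x : Word) (j : ℕ) :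
    shiftL^[j] (prefixL x g) ≤ prefixL x (shiftL^[j] g) ∧
      prefixL x (shiftL^[j] g) ≤ shiftL^[j] (prefixL x g) + (j : ℝ) • errL x g := by
  have herr : 0 ≤ errL x g := by simpa using errL_mono x hg.nonneg
  induction j with
  | zero => simp
  | succ j ih =>
    obtain ⟨h1, h2⟩ := shiftL_prefixL_le (hg.iterate j).1 x
    simp only [Function.iterate_succ_apply']
    refine ⟨(shiftL_mono ih.1).trans h1, fun n => ?_⟩
    have h3 := h2 n
    have h4 := shiftL_mono ih.2 n
    have h5 := errL_mono x (hg.iterate j).2 n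
    -- The error sequence is itself nondecreasing, so shifting the errors of earlier steps does not
    -- enlarge them.
    have h6 : shiftL (errL x g) n ≤ errL x g n := by
      have hasc : Ascending (errL x g) := by
        clear ih h1 h2 h3 h4 h5
        induction x with
        | nil => exact ⟨rfl, fun _ _ _ => le_rfl⟩
        | cons a x ihx =>
          have hx : 0 ≤ errL x g := by simpa using errL_mono x hg.nonneg
          cases a
          · exact ascending_psum hx
          · have h1 := ascending_psum (hg.prefixL x).nonneg
            have h2 := ascending_psum (g := eulerL (errL x g))
              (by simpa using eulerL_mono hx)
            exact ⟨by simp [errL], h1.mono.add h2.mono⟩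
      exact hasc.shiftL_le n
    rw [map_add, map_smul] at h4
    simp only [Pi.add_apply, Pi.smul_apply, smul_eq_mul] at *
    push_cast
    have := mul_le_mul_of_nonneg_left h6 j.cast_nonneg (α := ℝ)
    linarith

theorem iterate_shiftL_apply (g : ℕ → ℝ) (j n : ℕ) :
    shiftL^[j] g n = if j ≤ n then g (n - j) else 0 := by
  induction j generalizing n with
  | zero => simp
  | succ j ih =>
    rw [Function.iterate_succ_apply']
    cases n with
    | zero => simp
    | succ n => simp [ih]

/-! ### Growth of the root counts -/

theorem psum_ratio_upper {g : ℕ → ℝ} {r : ℝ} (h : ∀ n : ℕ, (n + r) * g n ≤ n * g (n + 1)) (n : ℕ) :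
    (r + 1) * psum g n ≤ n * g (n + 1) := by
  induction n with
  | zero => simp
  | succ n ih =>
    have := h (n + 1)
    rw [psum_succ]
    push_cast at *
    linarith

theorem psum_ratio_lower {g : ℕ → ℝ} (hg : 0 ≤ g) {r d : ℝ} (hd : 0 ≤ d)
    (h : ∀ n : ℕ, (n - d) * g (n + 1) ≤ (n + r) * g n) (n : ℕ) :
    (n - d) * g (n + 1) ≤ (r + 1 + d) * psum g n := by
  induction n with
  | zero =>
    have := mul_nonneg hd (hg 1)
    simpa using this
  | succ n ih =>
    have := h (n + 1)
    rw [psum_succ]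
    push_cast at *
    linarith

/-- Such ratio bounds pass to partial sums by induction on n, with the length raised by one. The
factor m from a leading two only weakens the lower bound on the ratio, by one unit per two. With
boundedly many twos, both bounds have the same limit. -/
theorem cnt_ratio (v : Word) (n : ℕ) :
    (n - twos v) * cnt [] v (n + 1) ≤ (n + v.length) * cnt [] v n ∧
      (n + v.length) * cnt [] v n ≤ n * cnt [] v (n + 1) := by
  induction v generalizing n with
  | nil =>
    cases n with
    | zero => simp
    | succ n => simp [cnt_self]
  | cons a v ih =>
    have h0 : 0 ≤ cnt [] v := fun n => cnt_nonneg _ _ n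
    cases a
    · rw [cnt_one (by simp), psum_succ]
      have h1 := psum_ratio_upper (fun n => (ih n).2) n
      have h2 := psum_ratio_lower h0 (twos v).cast_nonneg (fun n => (ih n).1) n
      simp only [twos_one, List.length_cons]
      push_cast
      constructor <;> linarith
    · rw [cnt_two_nil, psum_succ]
      have h3 : ∀ n : ℕ, (n + (v.length : ℝ)) * (n * cnt [] v n) ≤
          n * ((n + 1 : ℕ) * cnt [] v (n + 1)) := by
        intro n
        have h4 := mul_le_mul_of_nonneg_left (ih n).2 n.cast_nonneg (α := ℝ)
        have h5 := mul_nonneg n.cast_nonneg (h0 (n + 1)) (α := ℝ)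
        push_cast
        linarith
      have h6 : ∀ n : ℕ, (n - ((twos v : ℝ) + 1)) * ((n + 1 : ℕ) * cnt [] v (n + 1)) ≤
          (n + (v.length : ℝ)) * (n * cnt [] v n) := by
        intro n
        have h4 := mul_le_mul_of_nonneg_left (ih n).1 n.cast_nonneg (α := ℝ)
        have h5 := mul_nonneg (add_nonneg (twos v).cast_nonneg zero_le_one) (h0 (n + 1)) (α := ℝ)
        push_cast
        linarith
      have h1 := psum_ratio_upper h3 n
      have h2 := psum_ratio_lower (fun n => mul_nonneg n.cast_nonneg (h0 n)) (by positivity) h6 n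
      simp only [twos_two, List.length_cons]
      push_cast at *
      constructor <;> linarith

/-! ### The cost of replacing a two by a one -/

theorem replace_two (x u : Word) {n : ℕ} (hn : twos x + twos u ≤ n) :
    ((u.length : ℝ) + 1) * (((n : ℝ) - (twos x + twos u)) / (n + (x.length + u.length + 2)))
        * cnt [] (x ++ Digit.one :: u) (n + 1) ≤ cnt [] (x ++ Digit.two :: u) (n + 1) := by
  set f := cnt [] u with hf
  have hasc := ascending_cnt_nil u
  have hf1 : cnt [] (x ++ Digit.one :: u) = prefixL x (psum f) := by
    rw [cnt_nil_append, cnt_one (by simp)]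
  have hf11 : cnt [] (x ++ Digit.one :: Digit.one :: u) = prefixL x (psum (psum f)) := by
    rw [cnt_nil_append, cnt_one (by simp), cnt_one (by simp)]
  have hf2 : cnt [] (x ++ Digit.two :: u) = prefixL x (psumL (eulerL f)) := by
    rw [cnt_nil_append, cnt_two_nil]
    rfl
  -- The word x11u interpolates: its count is bounded above through those of x2u and x1u. The bounds
  -- `h3` and `h7` then give c ≥ (1+ρ)a, which leaves at least (#u+1)ρ times the count of x1u for
  -- x2u.
  have h1 : ((u.length : ℝ) + 1) • psum f ≤ eulerL f + (u.length : ℝ) • f := by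
    intro n
    cases n with
    | zero => simp [hf]
    | succ n =>
      have := psum_ratio_upper (fun n => (cnt_ratio u n).2) n
      rw [← hf] at this
      simp only [Pi.smul_apply, Pi.add_apply, smul_eq_mul, eulerL_apply, psum_succ]
      push_cast
      linarith
  have h2 := prefixL_mono x (psumL_mono h1) (n + 1)
  simp only [map_add, map_smul, Pi.add_apply, Pi.smul_apply, smul_eq_mul] at h2
  rw [← hf2, psumL_apply f, psumL_apply, ← hf11, ← hf1] at h2
  have h3 : cnt [] (x ++ Digit.one :: u) (n + 1) ≤
      cnt [] (x ++ Digit.one :: Digit.one :: u) (n + 1)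
        - cnt [] (x ++ Digit.one :: Digit.one :: u) n := by
    have h4 := (shiftL_prefixL_le (ascending_psum (ascending_psum hasc.nonneg).nonneg) x).1 (n + 1)
    rw [shiftL_succ, ← hf, ← hf11] at h4
    have h5 := congrArg (fun g => prefixL x g (n + 1)) (psum_sub_shiftL (psum_zero f))
    simp only [map_sub, Pi.sub_apply] at h5
    rw [← hf11, ← hf1] at h5
    linarith
  have h6 := (cnt_ratio (x ++ Digit.one :: Digit.one :: u) n).1
  simp only [twos_append, twos_one, List.length_append, List.length_cons] at h6
  push_cast at h6
  set c := cnt [] (x ++ Digit.one :: Digit.one :: u) (n + 1)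
  set c' := cnt [] (x ++ Digit.one :: Digit.one :: u) n
  set a := cnt [] (x ++ Digit.one :: u) (n + 1)
  set ρ := ((n : ℝ) - (twos x + twos u)) / (n + (x.length + u.length + 2)) with hρ
  have hpos : (0 : ℝ) < n + (x.length + u.length + 2) := by positivity
  have hn' : (0 : ℝ) ≤ (n : ℝ) - (twos x + twos u) := by
    rw [sub_nonneg]; exact_mod_cast hn
  have hρ0 : 0 ≤ ρ := div_nonneg hn' hpos.le
  have h7 : ρ * c ≤ c' := by
    rw [hρ, div_mul_eq_mul_div, div_le_iff₀ hpos]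
    linarith
  have hc' : 0 ≤ c' := cnt_nonneg _ _ _
  have h8 : ρ * a ≤ ρ * c := mul_le_mul_of_nonneg_left (by linarith) hρ0
  have h9 : (1 + ρ) * a ≤ c := by linarith
  have h10 := mul_le_mul_of_nonneg_left h9 (by positivity : (0 : ℝ) ≤ u.length + 1)
  have ha : 0 ≤ a := cnt_nonneg _ _ _
  linarith

/-- The error operator sums over the twos of x, so a common bound for single replacements is
multiplied by their number. The prefix x' keeps the digits already passed in the induction. -/
theorem errL_le_of_replace (x' x y : Word) (n : ℕ) (c : ℝ)
    (h : ∀ x₁ x₂, x' ++ x = x₁ ++ Digit.two :: x₂ → (x' <+: x₁) →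
      cnt [] (x₁ ++ Digit.one :: (x₂ ++ y)) n ≤ c * cnt [] (x₁ ++ Digit.two :: (x₂ ++ y)) n) :
    prefixL x' (errL x (cnt [] y)) n ≤ twos x * (c * cnt [] (x' ++ (x ++ y)) n) := by
  induction x generalizing x' with
  | nil => simp [errL]
  | cons a x ih =>
    cases a
    · have := ih (x' ++ [Digit.one]) (fun x₁ x₂ h1 h2 => h x₁ x₂ (by simpa using h1)
        ((List.prefix_append _ _).trans h2))
      simpa [prefixL_append, prefixL, errL] using this
    · have h1 := ih (x' ++ [Digit.two]) (fun x₁ x₂ h1 h2 => h x₁ x₂ (by simpa using h1)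
        ((List.prefix_append _ _).trans h2))
      have h2 := h x' x rfl (List.prefix_rfl)
      rw [cnt_nil_append x', cnt_one (by simp), cnt_nil_append x] at h2
      simp only [prefixL_append, prefixL, errL, List.append_assoc, List.cons_append,
        List.nil_append, LinearMap.comp_apply, LinearMap.id_apply, LinearMap.add_apply, map_add,
        Pi.add_apply, twos_two, psumL_apply] at h1 h2 ⊢
      push_cast
      linarith

theorem errL_le (x y : Word) {n : ℕ} (hn : twos x + twos y ≤ n) :
    ((y.length : ℝ) + 1) * (((n : ℝ) - (twos x + twos y)) / (n + (x.length + y.length + 1)))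
        * errL x (cnt [] y) (n + 1) ≤ twos x * cnt [] (x ++ y) (n + 1) := by
  have hn' : (0 : ℝ) ≤ (n : ℝ) - (twos x + twos y) := by
    rw [sub_nonneg]; exact_mod_cast hn
  have hpos : (0 : ℝ) < n + (x.length + y.length + 1) := by positivity
  set ρ := ((n : ℝ) - (twos x + twos y)) / (n + (x.length + y.length + 1)) with hρ
  have hρ0 : 0 ≤ ρ := div_nonneg hn' hpos.le
  rcases hρ0.eq_or_lt with h0 | h0
  · rw [← h0]
    simpa using mul_nonneg (twos x).cast_nonneg (cnt_nonneg _ _ _)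
  have hs : 0 < ((y.length : ℝ) + 1) * ρ := by positivity
  have := errL_le_of_replace [] x y (n + 1) ((((y.length : ℝ) + 1) * ρ)⁻¹) ?_
  · simp only [prefixL, LinearMap.id_apply, List.nil_append] at this
    rwa [mul_left_comm, ← div_eq_inv_mul, le_div_iff₀' hs] at this
  · rintro x₁ x₂ h -
    rw [List.nil_append] at h
    subst h
    rw [← div_eq_inv_mul, le_div_iff₀' hs]
    simp only [twos_append, twos_two, List.length_append, List.length_cons] at hn hρ
    -- The part to the right of the replaced two is x₂y, which is at least as long as y and leaves
    -- the denominators equal. The replaced two is no longer subtracted, so the numerator only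
    -- grows.
    refine le_trans ?_ (replace_two x₁ (x₂ ++ y) (by rw [twos_append]; omega))
    refine mul_le_mul_of_nonneg_right ?_ (cnt_nonneg _ _ _)
    rw [hρ]
    simp only [twos_append, List.length_append]
    push_cast at *
    refine mul_le_mul (by linarith) (div_le_div₀ ?_ (by linarith) (by positivity) (by linarith))
      (hρ ▸ hρ0) (by positivity)
    have : (twos x₁ : ℝ) + (twos x₂ + 1) + twos y ≤ n := by exact_mod_cast hn
    linarith

theorem abs_psumL_le (g : ℕ → ℝ) (n : ℕ) : |psumL g n| ≤ psumL |g| n :=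
  Finset.abs_sum_le_sum_abs (fun m => g (m + 1)) (Finset.range n)

/-- For general w, the recursion under a leading two differs from that of ε only by terms without
the Euler factor, and these are dominated by root counts. The length condition excludes the
exceptional case w = 1xy in the recursion under a one. -/
theorem abs_cnt_sub_le (x y : Word) {w : Word} (hw : w.length ≤ y.length) :
    |cnt w (x ++ y) - prefixL x (cnt w y)| ≤ errL x (cnt [] y) := by
  induction x with
  | nil => simp [prefixL, errL]
  | cons a x ih =>
    cases a
    · rw [List.cons_append, cnt_one]
      · simp only [prefixL, errL, LinearMap.comp_apply]
        rw [← psumL_apply, ← map_sub]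
        exact fun n => (abs_psumL_le _ n).trans (psumL_mono ih n)
      · intro h
        have := congrArg List.length h
        simp at this
        omega
    · simp only [prefixL, errL, LinearMap.comp_apply, LinearMap.add_apply]
      rw [← cnt_nil_append]
      have h1 : ∀ n, |psumL (eulerL (cnt w (x ++ y))) n - psumL (eulerL (prefixL x (cnt w y))) n| ≤
          psumL (eulerL (errL x (cnt [] y))) n := by
        intro n
        have h2 := abs_psumL_le (eulerL (cnt w (x ++ y) - prefixL x (cnt w y))) n
        rw [map_sub, map_sub] at h2
        refine h2.trans (psumL_mono (fun m => ?_) n)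
        rw [← map_sub, Pi.abs_apply, eulerL_apply, eulerL_apply, abs_mul, Nat.abs_cast]
        exact mul_le_mul_of_nonneg_left (ih m) m.cast_nonneg
      have hle : ∀ z, cnt z (x ++ y) ≤ cnt [] (x ++ y) := fun z => cnt_le_root z _
      have h0 : ∀ z, 0 ≤ cnt z (x ++ y) := fun z => cnt_nonneg z _
      -- The correction terms have opposite signs and each lies between 0 and the partial sum of the
      -- root counts, so one such partial sum bounds their difference.
      have h2 : ∀ n, |cnt w (Digit.two :: (x ++ y)) n - psumL (eulerL (cnt w (x ++ y))) n| ≤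
          psumL (cnt [] (x ++ y)) n := by
        intro n
        have k1 := psumL_mono (hle w) n
        have k2 := psumL_mono (h0 w) n
        rw [map_zero, Pi.zero_apply] at k2
        cases w with
        | nil =>
          rw [cnt_two_nil]
          have : psum (fun m : ℕ => (m : ℝ) * cnt [] (x ++ y) m) n =
            psumL (eulerL (cnt [] (x ++ y))) n := rfl
          rw [this, sub_self, abs_zero]
          exact k2
        | cons a w =>
          have k3 := psumL_mono (hle w) n
          have k4 := psumL_mono (h0 w) n
          rw [map_zero, Pi.zero_apply] at k4
          cases a
          · have : (fun m : ℕ => ((m : ℝ) - 1) * cnt (Digit.one :: w) (x ++ y) m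
                + cnt w (x ++ y) m) = eulerL (cnt (Digit.one :: w) (x ++ y))
                  - cnt (Digit.one :: w) (x ++ y) + cnt w (x ++ y) := by
              funext m; simp; ring
            rw [cnt_two_one, this, ← psumL_apply, map_add, map_sub]
            simp only [Pi.add_apply, Pi.sub_apply]
            rw [abs_le]
            constructor <;> linarith
          · have : (fun m : ℕ => ((m : ℝ) - 1) * cnt (Digit.two :: w) (x ++ y) m) =
                eulerL (cnt (Digit.two :: w) (x ++ y)) - cnt (Digit.two :: w) (x ++ y) := by
              funext m; simp; ring
            rw [cnt_two_two, this, ← psumL_apply, map_sub]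
            have k5 : cnt w (x ++ y) n ≤ psumL (cnt [] (x ++ y)) n := by
              cases n with
              | zero => simp
              | succ n =>
                rw [psumL_apply, psum_succ]
                have := (ascending_psum (ascending_cnt_nil (x ++ y)).nonneg).nonneg n
                have := hle w (n + 1)
                simp only [Pi.zero_apply] at *
                linarith
            have k6 := h0 w n
            simp only [Pi.add_apply, Pi.sub_apply, Pi.zero_apply] at *
            rw [abs_le]
            constructor <;> linarith
      intro n
      have k1 := h1 n
      have k2 := h2 n
      simp only [Pi.abs_apply, Pi.sub_apply, Pi.add_apply, List.cons_append] at *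
      rw [abs_le] at *
      constructor <;> linarith

/-- The coefficients of `gen_replicate_append`: multiplication by X becomes the shift. -/
theorem cnt_replicate_append {w v : Word} {N : ℕ} (hN : w.length ≤ N) :
    cnt w (List.replicate N Digit.one ++ v) =
      ∑ j ∈ Finset.range ((limitPoly v w).natDegree + 1), (limitPoly v w).coeff j •
        shiftL^[j] (cnt [] (List.replicate (N + weight v) Digit.one)) := by
  funext n
  have h := congrArg (PowerSeries.coeff n) (gen_replicate_append (v := v) hN)
  have hp : (limitPoly v w : PowerSeries ℝ) =
      ∑ j ∈ Finset.range ((limitPoly v w).natDegree + 1),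
        PowerSeries.C ((limitPoly v w).coeff j) * PowerSeries.X ^ j := by
    conv_lhs => rw [(limitPoly v w).as_sum_range_C_mul_X_pow]
    rw [← Polynomial.coeToPowerSeries.ringHom_apply, map_sum]
    simp
  rw [hp, gen, PowerSeries.coeff_mk, Finset.sum_mul, map_sum] at h
  rw [h, Finset.sum_apply]
  refine Finset.sum_congr rfl fun j _ => ?_
  rw [mul_assoc, PowerSeries.coeff_C_mul, PowerSeries.coeff_X_pow_mul', Pi.smul_apply,
    iterate_shiftL_apply, gen, PowerSeries.coeff_mk, smul_eq_mul]

/-! ### Limits of ratios of chain counts -/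

theorem tendsto_ratio_add {n L : ℕ → ℕ} {p : ℝ} (hn : Tendsto n atTop atTop)
    (hr : Tendsto (fun m => (n m : ℝ) / (n m + L m)) atTop (𝓝 p)) (a b : ℝ) :
    Tendsto (fun m => ((n m : ℝ) + a) / (n m + L m + b)) atTop (𝓝 p) := by
  have hs : Tendsto (fun m => (n m : ℝ) + L m) atTop atTop :=
    tendsto_atTop_mono (fun m => le_add_of_nonneg_right (L m).cast_nonneg)
      (tendsto_natCast_atTop_atTop.comp hn)
  have h := ((hr.add (hs.const_div_atTop a)).div ((hs.const_div_atTop b).const_add 1)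
    (by norm_num))
  simp only [add_zero, div_one] at h
  refine h.congr' ?_
  filter_upwards [hs.eventually_gt_atTop 0] with m hm
  rw [Pi.div_apply, ← add_div, one_add_div hm.ne', div_div_div_cancel_right₀ hm.ne']

theorem tendsto_natSub {n : ℕ → ℕ} (hn : Tendsto n atTop atTop) (j : ℕ) :
    Tendsto (fun m => n m - j) atTop atTop :=
  (tendsto_sub_atTop_nat j).comp hn

theorem tendsto_ratio_natSub {n L : ℕ → ℕ} {p : ℝ} (hn : Tendsto n atTop atTop)
    (hr : Tendsto (fun m => (n m : ℝ) / (n m + L m)) atTop (𝓝 p)) (j : ℕ) :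
    Tendsto (fun m => ((n m - j : ℕ) : ℝ) / ((n m - j : ℕ) + L m)) atTop (𝓝 p) := by
  refine (tendsto_ratio_add hn hr (-j) (-j)).congr' ?_
  filter_upwards [hn.eventually_ge_atTop j] with m hm
  rw [Nat.cast_sub hm]
  congr 1
  ring

theorem tendsto_cnt_pred {u : ℕ → Word} {n : ℕ → ℕ} {K : ℕ} {p : ℝ} (hu : ∀ m, twos (u m) ≤ K)
    (hn : Tendsto n atTop atTop)
    (hr : Tendsto (fun m => (n m : ℝ) / (n m + (u m).length)) atTop (𝓝 p)) :
    Tendsto (fun m => cnt [] (u m) (n m - 1) / cnt [] (u m) (n m)) atTop (𝓝 p) := by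
  refine tendsto_of_tendsto_of_tendsto_of_le_of_le' (tendsto_ratio_add hn hr (-1 - K) (-1))
    (tendsto_ratio_add hn hr (-1) (-1)) ?_ ?_
  all_goals
    filter_upwards [hn.eventually_ge_atTop 2] with m hm
    obtain ⟨k, hk⟩ := Nat.exists_eq_add_of_le' hm
    obtain ⟨h1, h2⟩ := cnt_ratio (u m) (k + 1)
    have hpos : 0 < cnt [] (u m) (k + 2) := cnt_pos (below_nil _) (by omega)
    have hK : (twos (u m) : ℝ) ≤ K := by exact_mod_cast hu m
    rw [hk, show k + 2 - 1 = k + 1 by omega]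
    push_cast at *
    have hlen : (0 : ℝ) < (k : ℝ) + 2 + (u m).length + -1 := by
      have := k.cast_nonneg (α := ℝ)
      have := (u m).length.cast_nonneg (α := ℝ)
      linarith
  · rw [div_le_div_iff₀ hlen hpos]
    have := mul_le_mul_of_nonneg_right hK hpos.le
    linarith
  · rw [div_le_div_iff₀ hpos hlen]
    linarith

theorem tendsto_cnt_sub {u : ℕ → Word} {n : ℕ → ℕ} {K : ℕ} {p : ℝ} (hu : ∀ m, twos (u m) ≤ K)
    (hn : Tendsto n atTop atTop)
    (hr : Tendsto (fun m => (n m : ℝ) / (n m + (u m).length)) atTop (𝓝 p)) (j : ℕ) :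
    Tendsto (fun m => cnt [] (u m) (n m - j) / cnt [] (u m) (n m)) atTop (𝓝 (p ^ j)) := by
  induction j with
  | zero =>
    rw [pow_zero]
    refine tendsto_const_nhds.congr' ?_
    filter_upwards [hn.eventually_ne_atTop 0] with m hm
    rw [Nat.sub_zero, div_self (cnt_pos (below_nil _) hm).ne']
  | succ j ih =>
    have h := (tendsto_cnt_pred hu (tendsto_natSub hn j) (tendsto_ratio_natSub hn hr j)).mul ih
    rw [pow_succ']
    refine h.congr' ?_
    filter_upwards [hn.eventually_gt_atTop j] with m hm
    rw [Nat.sub_sub, div_mul_div_cancel₀ (cnt_pos (below_nil _) (by omega)).ne']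

/-- By `errL_le` the relative error is at most K divided by a quantity asymptotic to p·#y. This is
where p > 0 is essential. -/
theorem tendsto_errL {x y : ℕ → Word} {n : ℕ → ℕ} {K : ℕ} {p : ℝ} (hp : 0 < p)
    (hK : ∀ m, twos (x m ++ y m) ≤ K) (hn : Tendsto n atTop atTop)
    (hr : Tendsto (fun m => (n m : ℝ) / (n m + (x m ++ y m).length)) atTop (𝓝 p))
    (hy : Tendsto (fun m => (y m).length) atTop atTop) :
    Tendsto (fun m => errL (x m) (cnt [] (y m)) (n m) / cnt [] (x m ++ y m) (n m)) atTop (𝓝 0) := by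
  have h1 : Tendsto (fun m => ((y m).length + 1 : ℝ) *
      (((n m : ℝ) + (-1 - K)) / (n m + (x m ++ y m).length + 0))) atTop atTop :=
    Tendsto.atTop_mul_pos hp
      (tendsto_atTop_add_const_right _ _ (tendsto_natCast_atTop_atTop.comp hy))
      (tendsto_ratio_add hn hr _ _)
  refine squeeze_zero' (g := fun m => (K : ℝ) / (((y m).length + 1 : ℝ) *
      (((n m : ℝ) + (-1 - K)) / (n m + (x m ++ y m).length + 0)))) ?_ ?_ (h1.const_div_atTop _)
  · filter_upwards with m
    have h0 : 0 ≤ errL (x m) (cnt [] (y m)) := by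
      simpa using errL_mono (x m) (ascending_cnt_nil (y m)).nonneg
    exact div_nonneg (h0 _) (cnt_nonneg _ _ _)
  · filter_upwards [hn.eventually_ge_atTop (K + 2)] with m hm
    obtain ⟨k, hk⟩ := Nat.exists_eq_add_of_le' hm
    have hKm := hK m
    rw [twos_append] at hKm
    have h2 := errL_le (x m) (y m) (n := k + K + 1) (by omega)
    have hpos : 0 < cnt [] (x m ++ y m) (n m) := cnt_pos (below_nil _) (by omega)
    rw [show k + K + 1 + 1 = n m by omega] at h2
    have hKr : (twos (x m) : ℝ) + twos (y m) ≤ K := by exact_mod_cast hKm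
    have hn1 : ((k + K + 1 : ℕ) : ℝ) = n m - 1 := by rw [hk]; push_cast; ring
    have hn2 : (k : ℝ) + K + 2 = n m := by rw [hk]; push_cast; ring
    have hk0 := k.cast_nonneg (α := ℝ)
    have hK0 := K.cast_nonneg (α := ℝ)
    have hd1 := (twos (x m)).cast_nonneg (α := ℝ)
    have hd2 := (twos (y m)).cast_nonneg (α := ℝ)
    rw [hn1] at h2
    have hle : ((n m : ℝ) + (-1 - K)) / (n m + (x m ++ y m).length + 0) ≤
        ((n m : ℝ) - 1 - (twos (x m) + twos (y m))) /
          (n m - 1 + ((x m).length + (y m).length + 1)) := by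
      rw [List.length_append]
      push_cast
      refine div_le_div₀ (by linarith) (by linarith) ?_ (by linarith)
      have := (x m).length.cast_nonneg (α := ℝ)
      have := (y m).length.cast_nonneg (α := ℝ)
      linarith
    have h0 : 0 ≤ errL (x m) (cnt [] (y m)) (n m) := by
      simpa using errL_mono (x m) (ascending_cnt_nil (y m)).nonneg (n m)
    have hq : (0 : ℝ) < ((n m : ℝ) + (-1 - K)) / (n m + (x m ++ y m).length + 0) :=
      div_pos (by linarith) (by have := (x m ++ y m).length.cast_nonneg (α := ℝ); linarith)
    have hb : (0 : ℝ) < (y m).length + 1 := by positivity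
    rw [div_le_div_iff₀ hpos (by positivity)]
    calc errL (x m) (cnt [] (y m)) (n m) * (((y m).length + 1 : ℝ) *
          (((n m : ℝ) + (-1 - K)) / (n m + (x m ++ y m).length + 0)))
        ≤ errL (x m) (cnt [] (y m)) (n m) * (((y m).length + 1 : ℝ) *
          (((n m : ℝ) - 1 - (twos (x m) + twos (y m))) /
          (n m - 1 + ((x m).length + (y m).length + 1)))) :=
          mul_le_mul_of_nonneg_left (mul_le_mul_of_nonneg_left hle hb.le) h0
      _ ≤ twos (x m) * cnt [] (x m ++ y m) (n m) := by rw [mul_comm]; exact h2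
      _ ≤ K * cnt [] (x m ++ y m) (n m) :=
          mul_le_mul_of_nonneg_right (by linarith) hpos.le

theorem tendsto_cnt_div {x : ℕ → Word} {N n : ℕ → ℕ} {v w : Word} {K : ℕ} {p : ℝ}
    (hp : p ∈ Set.Ioo (0 : ℝ) 1)
    (hK : ∀ m, twos (x m ++ (List.replicate (N m) Digit.one ++ v)) ≤ K)
    (hn : Tendsto n atTop atTop) (hN : Tendsto N atTop atTop)
    (hr : Tendsto (fun m => (n m : ℝ) /
      (n m + (x m ++ (List.replicate (N m) Digit.one ++ v)).length)) atTop (𝓝 p)) :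
    Tendsto (fun m => cnt w (x m ++ (List.replicate (N m) Digit.one ++ v)) (n m) /
      cnt [] (x m ++ (List.replicate (N m) Digit.one ++ v)) (n m)) atTop (𝓝 (psi v p w)) := by
  set z : ℕ → Word := fun m => List.replicate (N m) Digit.one ++ v with hz
  -- The reference word xy differs in length from the given word only by the constant |v|-#v, so it
  -- has the same limit p. All counts are compared with its root count A.
  set y : ℕ → Word := fun m => List.replicate (N m + weight v) Digit.one with hy
  set A : ℕ → ℝ := fun m => cnt [] (x m ++ y m) (n m) with hA
  have hKy : ∀ m, twos (x m ++ y m) ≤ K := fun m => by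
    have := hK m
    simp only [hy, twos_append, twos_replicate] at this ⊢
    omega
  have hry : Tendsto (fun m => (n m : ℝ) / (n m + (x m ++ y m).length)) atTop (𝓝 p) := by
    refine (tendsto_ratio_add hn hr 0 ((weight v : ℝ) - v.length)).congr fun m => ?_
    simp only [hy, List.length_append, List.length_replicate]
    push_cast
    congr 1 <;> ring
  have hylen : Tendsto (fun m => (y m).length) atTop atTop := by
    simp only [hy, List.length_replicate]
    exact tendsto_atTop_mono (fun m => Nat.le_add_right _ _) hN
  have hzlen : Tendsto (fun m => (z m).length) atTop atTop := by
    simp only [hz, List.length_append, List.length_replicate]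
    exact tendsto_atTop_mono (fun m => Nat.le_add_right _ _) hN
  have hApos : ∀ᶠ m in atTop, 0 < A m := by
    filter_upwards [hn.eventually_ne_atTop 0] with m hm using cnt_pos (below_nil _) hm
  have herr := tendsto_errL hp.1 hKy hn hry hylen
  have hshift : ∀ j, Tendsto (fun m => prefixL (x m) (shiftL^[j] (cnt [] (y m))) (n m) / A m)
      atTop (𝓝 (p ^ j)) := by
    intro j
    have h1 := tendsto_cnt_sub hKy hn hry j
    have h2 := h1.add (herr.const_mul (j : ℝ))
    rw [mul_zero, add_zero] at h2
    refine tendsto_of_tendsto_of_tendsto_of_le_of_le' h1 h2 ?_ ?_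
    all_goals
      filter_upwards [hApos, hn.eventually_ge_atTop j] with m hm hj
      obtain ⟨k1, k2⟩ := iterate_shiftL_prefixL (ascending_cnt_nil (y m)) (x m) j
      replace k1 := k1 (n m)
      replace k2 := k2 (n m)
      rw [← cnt_nil_append] at k1 k2
      rw [iterate_shiftL_apply, if_pos hj] at k1
      rw [Pi.add_apply, iterate_shiftL_apply, if_pos hj, Pi.smul_apply, smul_eq_mul] at k2
    · exact div_le_div_of_nonneg_right k1 hm.le
    · rw [← mul_div_assoc, ← add_div]
      exact div_le_div_of_nonneg_right k2 hm.le
  have hpre : ∀ w : Word, Tendsto (fun m => prefixL (x m) (cnt w (z m)) (n m) / A m) atTop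
      (𝓝 ((limitPoly v w).eval p)) := by
    intro w
    rw [eval_eq_sum_range]
    refine (tendsto_finsetSum _ fun j _ => (hshift j).const_mul ((limitPoly v w).coeff j)).congr' ?_
    filter_upwards [hN.eventually_ge_atTop w.length] with m hm
    simp only [hz]
    rw [cnt_replicate_append hm, map_sum, Finset.sum_apply, Finset.sum_div]
    refine Finset.sum_congr rfl fun j _ => ?_
    rw [map_smul, Pi.smul_apply, smul_eq_mul, mul_div_assoc]
  have hroot : Tendsto (fun m => cnt [] (x m ++ z m) (n m) / A m) atTop
      (𝓝 ((Q [] v).eval p)) := by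
    simpa only [cnt_nil_append, limitPoly_nil] using hpre []
  have herr2 : Tendsto (fun m => errL (x m) (cnt [] (z m)) (n m) / A m) atTop (𝓝 0) := by
    have := (tendsto_errL hp.1 hK hn hr hzlen).mul hroot
    rw [zero_mul] at this
    refine this.congr' ?_
    filter_upwards [hn.eventually_ne_atTop 0] with m hm
    exact div_mul_div_cancel₀ (cnt_pos (below_nil _) hm).ne'
  have hw : Tendsto (fun m => cnt w (x m ++ z m) (n m) / A m) atTop
      (𝓝 ((limitPoly v w).eval p)) := by
    have h1 : Tendsto (fun m => cnt w (x m ++ z m) (n m) / A m -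
        prefixL (x m) (cnt w (z m)) (n m) / A m) atTop (𝓝 0) := by
      refine squeeze_zero_norm' ?_ herr2
      filter_upwards [hApos, hzlen.eventually_ge_atTop w.length] with m hm hl
      rw [← sub_div, Real.norm_eq_abs, abs_div, abs_of_pos hm]
      exact div_le_div_of_nonneg_right (abs_cnt_sub_le (x m) (z m) hl (n m)) hm.le
    simpa using h1.add (hpre w)
  refine (hw.div hroot (Q_pos hp (below_nil v)).ne').congr' ?_
  filter_upwards [hApos] with m hm
  exact div_div_div_cancel_right₀ hm.ne' _ _

/-! ### Limit functions for given parameters -/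

theorem proportion_eq {K : ℕ} {x y : Vertex K} (h : x.level < y.level) :
    proportion x y = (D [] x.word x.level : ℝ) *
      (cnt x.word y.word (y.level - x.level) / cnt [] y.word y.level) := by
  rw [proportion, pathCount, if_pos h.le, cnt_of_ne _ _ (by omega), cnt_of_ne _ _ (by omega)]

theorem isLimit_mu {K : ℕ} {V : ℕ → Vertex K} {p : ℝ} {v : Word}
    (hn : Tendsto (fun m => (V m).level) atTop atTop)
    (hr : Tendsto (fun m => ((V m).level : ℝ) / ((V m).level + (V m).word.length)) atTop (𝓝 p))
    (hp : p ∈ Set.Ioo (0 : ℝ) 1)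
    (hv : ∀ N : ℕ, ∀ᶠ m in atTop, (List.replicate N Digit.one ++ v) <:+ (V m).word) :
    IsLimit V (mu v p) := by
  classical
  set P : ℕ → ℕ → Prop := fun m N => (List.replicate N Digit.one ++ v) <:+ (V m).word with hP
  -- The longest available block of ones, capped at m: it tends to infinity because every fixed
  -- length is eventually available.
  set N : ℕ → ℕ := fun m => Nat.findGreatest (P m) m with hN
  have hNtop : Tendsto N atTop atTop := by
    refine tendsto_atTop.2 fun b => ?_
    filter_upwards [hv b, eventually_ge_atTop b] with m h1 h2
    exact Nat.le_findGreatest h2 h1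
  have hspec : ∀ᶠ m in atTop, P m (N m) := by
    filter_upwards [hv 0] with m hm
    exact Nat.findGreatest_spec (Nat.zero_le m) hm
  set x : ℕ → Word := fun m => if h : P m (N m) then h.choose else [] with hx
  have hxs : ∀ m, P m (N m) → x m ++ (List.replicate (N m) Digit.one ++ v) = (V m).word := by
    intro m hm
    rw [hx]
    simp only [dif_pos hm]
    exact hm.choose_spec
  have hvK : twos v ≤ K := by
    obtain ⟨m, hm⟩ := hspec.exists
    have := (V m).twos_le
    rw [← hxs m hm] at this
    simp only [twos_append] at this
    omega
  have hK : ∀ m, twos (x m ++ (List.replicate (N m) Digit.one ++ v)) ≤ K := by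
    intro m
    by_cases hm : P m (N m)
    · rw [hxs m hm]; exact (V m).twos_le
    · rw [hx]
      simp only [dif_neg hm]
      simpa using hvK
  have hr' : Tendsto (fun m => ((V m).level : ℝ) /
      ((V m).level + (x m ++ (List.replicate (N m) Digit.one ++ v)).length)) atTop (𝓝 p) := by
    refine hr.congr' ?_
    filter_upwards [hspec] with m hm
    rw [hxs m hm]
  intro z
  have h1 := tendsto_cnt_div (w := z.word) hp hK (tendsto_natSub hn z.level) hNtop
    (tendsto_ratio_natSub hn hr' z.level)
  have h2 := tendsto_cnt_sub (fun m => (V m).twos_le) hn hr z.level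
  rw [mu_eq, mul_assoc]
  refine Tendsto.congr' ?_ ((h2.mul h1).const_mul (D [] z.word z.level : ℝ))
  filter_upwards [hspec, hn.eventually_gt_atTop z.level] with m hm hl
  rw [proportion_eq hl, hxs m hm, mul_comm (_ / _) (_ / _),
    div_mul_div_cancel₀ (cnt_pos (below_nil _) (by omega)).ne']

/-- The root maximises the count, so at level l ≥ 1 the proportion is bounded by a constant times a
quantity tending to 0^l. -/
theorem isLimit_muZero {K : ℕ} {V : ℕ → Vertex K}
    (hn : Tendsto (fun m => (V m).level) atTop atTop)
    (hr : Tendsto (fun m => ((V m).level : ℝ) / ((V m).level + (V m).word.length)) atTop (𝓝 0)) :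
    IsLimit V muZero := by
  intro z
  have h := (tendsto_cnt_sub (fun m => (V m).twos_le) hn hr z.level).const_mul
    (D [] z.word z.level : ℝ)
  by_cases hz : z.level = 0
  · rw [muZero, if_pos hz]
    refine tendsto_const_nhds.congr' ?_
    filter_upwards [hn.eventually_gt_atTop z.level] with m hm
    rw [proportion_eq hm, z.root hz, hz, Nat.sub_zero,
      div_self (cnt_pos (below_nil _) (by omega)).ne', D_self]
    simp
  · rw [muZero, if_neg hz]
    rw [zero_pow hz, mul_zero] at h
    refine squeeze_zero' ?_ ?_ h
    · filter_upwards [hn.eventually_gt_atTop z.level] with m hm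
      rw [proportion_eq hm]
      have := cnt_nonneg z.word (V m).word ((V m).level - z.level)
      have := cnt_nonneg [] (V m).word (V m).level
      positivity
    · filter_upwards [hn.eventually_gt_atTop z.level] with m hm
      rw [proportion_eq hm]
      exact mul_le_mul_of_nonneg_left (div_le_div_of_nonneg_right (cnt_le_root _ _ _)
        (cnt_nonneg _ _ _)) (Nat.cast_nonneg _)

/-- The proportion through (ε,l) tends to 1^l = 1, and paths through another vertex of level l are
disjoint from these. -/
theorem isLimit_muOne {K : ℕ} {V : ℕ → Vertex K}
    (hn : Tendsto (fun m => (V m).level) atTop atTop)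
    (hr : Tendsto (fun m => ((V m).level : ℝ) / ((V m).level + (V m).word.length)) atTop (𝓝 1)) :
    IsLimit V muOne := by
  intro z
  have h := tendsto_cnt_sub (fun m => (V m).twos_le) hn hr z.level
  rw [one_pow] at h
  by_cases hz : z.word = []
  · rw [muOne, if_pos hz]
    refine h.congr' ?_
    filter_upwards [hn.eventually_gt_atTop z.level] with m hm
    rw [proportion_eq hm, hz, D_self, Nat.cast_one, one_mul]
  · rw [muOne, if_neg hz]
    have h' := h.const_sub 1
    rw [sub_self] at h'
    refine squeeze_zero' ?_ ?_ h'
    · filter_upwards [hn.eventually_gt_atTop z.level] with m hm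
      rw [proportion_eq hm]
      have := cnt_nonneg z.word (V m).word ((V m).level - z.level)
      have := cnt_nonneg [] (V m).word (V m).level
      positivity
    · filter_upwards [hn.eventually_gt_atTop z.level] with m hm
      have hpos : 0 < cnt [] (V m).word (V m).level := cnt_pos (below_nil _) (by omega)
      rw [proportion_eq hm, ← mul_div_assoc, le_sub_iff_add_le, ← add_div, div_le_one hpos]
      by_cases hb : Below z.word (V m).word
      · rw [cnt_of_ne _ _ (by omega), cnt_of_ne _ _ (by omega), cnt_of_ne _ _ (by omega)]
        have h1 := D_add [] (V m).word z.level ((V m).level - z.level)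
        rw [Nat.add_sub_cancel' hm.le] at h1
        have h2 : ∑ u ∈ ({z.word, []} : Finset Word),
            D [] u z.level * D u (V m).word ((V m).level - z.level) ≤
              D [] (V m).word (V m).level := by
          rw [h1]
          refine Finset.sum_le_sum_of_subset fun u hu => ?_
          rw [Finset.mem_insert, Finset.mem_singleton] at hu
          rcases hu with rfl | rfl
          · exact mem_down.2 hb
          · exact mem_down.2 (below_nil _)
        rw [Finset.sum_pair hz, D_self, one_mul] at h2
        exact_mod_cast h2
      · rw [cnt_eq_zero hb, mul_zero, zero_add, cnt_of_ne _ _ (by omega), cnt_of_ne _ _ (by omega)]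
        have h1 := D_add [] (V m).word z.level ((V m).level - z.level)
        rw [Nat.add_sub_cancel' hm.le] at h1
        have h2 := Finset.single_le_sum (f := fun u =>
          D [] u z.level * D u (V m).word ((V m).level - z.level))
          (fun _ _ => Nat.zero_le _) (mem_down.2 (below_nil (V m).word))
        rw [← h1] at h2
        simp only [D_self, one_mul] at h2
        exact_mod_cast h2

/-! ### Classification and existence of limit functions -/

theorem twos_paramWord (c : List ℕ) : twos (paramWord c) = c.length := by
  induction c with
  | nil => rfl
  | cons a c ih => simp [paramWord, ih]

theorem exists_eq_replicate_append (v : Word) :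
    ∃ (j : ℕ) (c : List ℕ), v = List.replicate j Digit.one ++ paramWord c := by
  induction v with
  | nil => exact ⟨0, [], rfl⟩
  | cons a v ih =>
    obtain ⟨j, c, rfl⟩ := ih
    cases a
    · exact ⟨j + 1, c, rfl⟩
    · exact ⟨0, j :: c, rfl⟩

/-- Call a word large if it is a suffix of z(m) for ultrafilter-many m. A large word can always be
extended to the left by some digit. Starting from one with the most twos, every extension must be by
ones. -/
theorem exists_frequently_suffix {K : ℕ} {z : ℕ → Word} (hK : ∀ m, twos (z m) ≤ K)
    (hz : Tendsto (fun m => (z m).length) atTop atTop) :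
    ∃ c : List ℕ, c.length ≤ K ∧
      ∀ N, ∃ᶠ m in atTop, (List.replicate N Digit.one ++ paramWord c) <:+ z m := by
  classical
  have hU : (hyperfilter ℕ : Filter ℕ) ≤ atTop := Nat.cofinite_eq_atTop ▸ hyperfilter_le_cofinite
  set S : Word → Prop := fun v => ∀ᶠ m in (hyperfilter ℕ : Filter ℕ), v <:+ z m with hS
  have hSK : ∀ v, S v → twos v ≤ K := by
    intro v hv
    obtain ⟨m, x, hx⟩ := hv.exists
    have := hK m
    rw [← hx, twos_append] at this
    omega
  have hstep : ∀ v, S v → S (Digit.one :: v) ∨ S (Digit.two :: v) := by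
    intro v hv
    refine Ultrafilter.eventually_or.1 ?_
    filter_upwards [hv, (hz.mono_left hU).eventually_gt_atTop v.length] with m h1 h2
    obtain ⟨x, hx⟩ := h1
    rcases List.eq_nil_or_concat' x with rfl | ⟨x, a, rfl⟩
    · rw [← hx] at h2
      simp at h2
    · rw [← hx, List.append_assoc]
      cases a
      · exact Or.inl ⟨x, rfl⟩
      · exact Or.inr ⟨x, rfl⟩
  set T : ℕ → Prop := fun k => ∃ v, S v ∧ twos v = k with hT
  have hT0 : T 0 := ⟨[], Eventually.of_forall fun m => List.nil_suffix, rfl⟩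
  obtain ⟨v, hv, hvk⟩ : T (Nat.findGreatest T K) := Nat.findGreatest_spec (Nat.zero_le K) hT0
  have hmax : ∀ u, S u → twos u ≤ twos v := fun u hu => by
    rw [hvk]
    exact Nat.le_findGreatest (hSK u hu) ⟨u, hu, rfl⟩
  have hrep : ∀ N, S (List.replicate N Digit.one ++ v) := by
    intro N
    induction N with
    | zero => exact hv
    | succ N ih =>
      rcases hstep _ ih with h | h
      · exact h
      · have := hmax _ h
        simp at this
  obtain ⟨j, c, rfl⟩ := exists_eq_replicate_append v
  refine ⟨c, ?_, fun N => ?_⟩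
  · have := hSK _ hv
    simpa [twos_paramWord] using this
  · refine Frequently.filter_mono (Eventually.frequently ?_) hU
    filter_upwards [hrep N] with m hm
    refine List.IsSuffix.trans ?_ hm
    rw [← List.append_assoc, List.replicate_append_replicate, add_comm,
      ← List.replicate_append_replicate, List.append_assoc]
    exact List.suffix_append _ _

theorem IsLimit.comp {K : ℕ} {V : ℕ → Vertex K} {μ : Vertex K → ℝ} (h : IsLimit V μ)
    {φ : ℕ → ℕ} (hφ : StrictMono φ) : IsLimit (V ∘ φ) μ :=
  fun x => (h x).comp hφ.tendsto_atTop

theorem IsLimit.unique {K : ℕ} {V : ℕ → Vertex K} {μ ν : Vertex K → ℝ} (h : IsLimit V μ)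
    (h' : IsLimit V ν) : μ = ν :=
  funext fun x => tendsto_nhds_unique (h x) (h' x)

theorem limit_classification {K : ℕ} {V : ℕ → Vertex K} {μ : Vertex K → ℝ}
    (hV : ¬ BddAbove (Set.range fun m => (V m).level)) (h : IsLimit V μ) :
    (∃ (c : List ℕ) (p : ℝ), c.length ≤ K ∧ p ∈ Set.Ioo (0 : ℝ) 1 ∧ μ = mu (paramWord c) p) ∨
      μ = muZero ∨ μ = muOne := by
  obtain ⟨φ, hφ, hlev⟩ : ∃ φ : ℕ → ℕ, StrictMono φ ∧ ∀ n, n ≤ (V (φ n)).level := by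
    refine extraction_forall_of_frequently (P := fun n k => n ≤ (V k).level) fun n => ?_
    by_contra hf
    rw [not_frequently] at hf
    exact hV (isBoundedUnder_of_eventually_le (a := n)
      (hf.mono fun m hm => (not_le.1 hm).le)).bddAbove_range
  have hn : Tendsto (fun m => ((V ∘ φ) m).level) atTop atTop := tendsto_atTop_mono hlev tendsto_id
  obtain ⟨p, hp, θ, hθ, hr⟩ := isCompact_Icc.tendsto_subseq (s := Set.Icc (0 : ℝ) 1)
    (x := fun m => (((V ∘ φ) m).level : ℝ) / (((V ∘ φ) m).level + ((V ∘ φ) m).word.length))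
    fun m => ⟨by positivity, div_le_one_of_le₀ (le_add_of_nonneg_right (Nat.cast_nonneg _))
      (by positivity)⟩
  set W := (V ∘ φ) ∘ θ with hW
  have hWn : Tendsto (fun m => (W m).level) atTop atTop := hn.comp hθ.tendsto_atTop
  have hWr : Tendsto (fun m => ((W m).level : ℝ) / ((W m).level + (W m).word.length)) atTop
      (𝓝 p) := hr
  have hWl : IsLimit W μ := (h.comp hφ).comp hθ
  rcases hp.1.eq_or_lt with rfl | hp0
  · exact Or.inr (Or.inl (hWl.unique (isLimit_muZero hWn hWr)))
  rcases hp.2.eq_or_lt with rfl | hp1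
  · exact Or.inr (Or.inr (hWl.unique (isLimit_muOne hWn hWr)))
  have hlen : Tendsto (fun m => (W m).word.length) atTop atTop := by
    rw [← tendsto_natCast_atTop_iff (R := ℝ)]
    -- Any number strictly between p and 1 will do: then the length is eventually at least a fixed
    -- positive multiple of the level.
    have hq : p < (1 + p) / 2 := by linarith
    have hq1 : (1 + p) / 2 < 1 := by linarith
    refine tendsto_atTop_mono' _ ?_ ((tendsto_natCast_atTop_atTop (R := ℝ)).comp hWn
      |>.atTop_mul_const (show 0 < (1 - (1 + p) / 2) / ((1 + p) / 2) by
        apply div_pos <;> linarith))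
    filter_upwards [hWr.eventually_lt_const hq, hWn.eventually_gt_atTop 0] with m hm hpos
    have hpos' : (0 : ℝ) < (W m).level := by exact_mod_cast hpos
    rw [div_lt_iff₀ (by positivity)] at hm
    rw [Function.comp_apply, ← mul_div_assoc, div_le_iff₀ (by linarith)]
    linarith
  obtain ⟨c, hc, hfreq⟩ := exists_frequently_suffix (fun m => (W m).twos_le) hlen
  obtain ⟨η, hη, hsuf⟩ := extraction_forall_of_frequently hfreq
  refine Or.inl ⟨c, p, hc, ⟨hp0, hp1⟩, (hWl.comp hη).unique ?_⟩
  refine isLimit_mu (hWn.comp hη.tendsto_atTop) (hWr.comp hη.tendsto_atTop) ⟨hp0, hp1⟩ fun N => ?_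
  filter_upwards [eventually_ge_atTop N] with m hm
  refine List.IsSuffix.trans ?_ (hsuf m)
  obtain ⟨k, rfl⟩ := Nat.exists_eq_add_of_le' hm
  rw [← List.replicate_append_replicate, List.append_assoc]
  exact List.suffix_append _ _

theorem exists_isLimit_mu {K : ℕ} {c : List ℕ} {p : ℝ} (hc : c.length ≤ K)
    (hp : p ∈ Set.Ioo (0 : ℝ) 1) :
    ∃ V : ℕ → Vertex K, Tendsto (fun m => (V m).level) atTop atTop ∧
      IsLimit V (mu (paramWord c) p) := by
  have hp0 := hp.1
  have ha : 0 < (1 - p) / p := div_pos (sub_pos.2 hp.2) hp.1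
  -- Solves n/(n+N) ≈ p for N at level n = m+1; the length of v^k is negligible.
  set N : ℕ → ℕ := fun m => ⌊(1 - p) / p * ((m + 1 : ℕ) : ℝ)⌋₊ with hN
  have hn : Tendsto (fun m : ℕ => m + 1) atTop atTop := tendsto_add_atTop_nat 1
  have hnr : Tendsto (fun m : ℕ => ((m + 1 : ℕ) : ℝ)) atTop atTop :=
    tendsto_natCast_atTop_atTop.comp hn
  have hNtop : Tendsto N atTop atTop :=
    tendsto_nat_floor_atTop.comp (hnr.const_mul_atTop ha)
  have hq : Tendsto (fun m => (N m : ℝ) / ((m + 1 : ℕ) : ℝ)) atTop (𝓝 ((1 - p) / p)) :=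
    (tendsto_nat_floor_mul_div_atTop ha.le).comp hnr
  have hr : Tendsto (fun m => ((m + 1 : ℕ) : ℝ) / ((m + 1 : ℕ) + N m)) atTop (𝓝 p) := by
    have h1 := (hq.const_add 1).inv₀ (by positivity)
    have h2 : (1 + (1 - p) / p)⁻¹ = p := by field_simp; ring
    rw [h2] at h1
    refine h1.congr fun m => ?_
    have : ((m + 1 : ℕ) : ℝ) ≠ 0 := by positivity
    rw [one_add_div this, inv_div]
  refine ⟨fun m => ⟨List.replicate (N m) Digit.one ++ paramWord c, m + 1, ?_, by simp⟩, hn, ?_⟩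
  · simpa [twos_paramWord] using hc
  · refine isLimit_mu hn ?_ hp fun M => ?_
    · refine (tendsto_ratio_add hn hr 0 (paramWord c).length).congr fun m => ?_
      simp only [List.length_append, List.length_replicate]
      push_cast
      congr 1 <;> ring
    · filter_upwards [hNtop.eventually_ge_atTop M] with m hm
      obtain ⟨k, hk⟩ := Nat.exists_eq_add_of_le' hm
      simp only [hk]
      rw [← List.replicate_append_replicate, List.append_assoc]
      exact List.suffix_append _ _

theorem exists_isLimit_muZero (K : ℕ) :
    ∃ V : ℕ → Vertex K, Tendsto (fun m => (V m).level) atTop atTop ∧ IsLimit V muZero := by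
  have hn : Tendsto (fun m : ℕ => m + 1) atTop atTop := tendsto_add_atTop_nat 1
  refine ⟨fun m => ⟨List.replicate ((m + 1) * (m + 1)) Digit.one, m + 1, by simp, by simp⟩, hn,
    isLimit_muZero hn ?_⟩
  have h : Tendsto (fun m : ℕ => (1 : ℝ) / ((m + 1 : ℕ) + 1)) atTop (𝓝 0) :=
    (tendsto_atTop_add_const_right _ _ (tendsto_natCast_atTop_atTop.comp hn)).const_div_atTop 1
  refine h.congr fun m => ?_
  simp only [List.length_replicate]
  push_cast
  have : (m : ℝ) + 1 ≠ 0 := by positivity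
  field_simp
  ring

theorem exists_isLimit_muOne (K : ℕ) :
    ∃ V : ℕ → Vertex K, Tendsto (fun m => (V m).level) atTop atTop ∧ IsLimit V muOne := by
  have hn : Tendsto (fun m : ℕ => m + 1) atTop atTop := tendsto_add_atTop_nat 1
  refine ⟨fun m => ⟨[], m + 1, by simp, by simp⟩, hn, isLimit_muOne hn ?_⟩
  refine tendsto_const_nhds.congr fun m => ?_
  have : ((m + 1 : ℕ) : ℝ) ≠ 0 := by positivity
  simp only [List.length_nil, Nat.cast_zero, add_zero]
  rw [div_self this]

/-! ### Cylinders and uniqueness of central measures -/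

open scoped ENNReal

theorem Chain.below {w v : Word} {n : ℕ} (s : Chain w v n) (i : Fin (n + 1)) :
    Below (s.1 i) v := by
  induction n generalizing v with
  | zero =>
    obtain rfl : i = Fin.last 0 := Subsingleton.elim (α := Fin 1) _ _
    rw [s.2.2.1]
    exact Below.refl v
  | succ n ih =>
    induction i using Fin.lastCases with
    | last => rw [s.2.2.1]; exact Below.refl v
    | cast i =>
      have h1 := ih (⟨fun i => s.1 i.castSucc, s.2.1, rfl, fun i => s.2.2.2 i.castSucc⟩ :
        Chain w (s.1 (Fin.last n).castSucc) n) i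
      have h2 := s.2.2.2 (Fin.last n)
      rw [Fin.succ_last, s.2.2.1] at h2
      exact h1.trans h2

/-- The infinite path that follows a chain and then stays at its end. -/
def Chain.extend {K : ℕ} {v : Word} {n : ℕ} (hv : twos v ≤ K) (s : Chain [] v n) :
    PathSpace K :=
  ⟨fun i => s.1 ⟨min i n, by omega⟩, by
    refine ⟨?_, fun i => ⟨(s.below _).twos_le.trans hv, ?_⟩⟩
    · have := s.2.1
      simpa using this
    · by_cases hi : i < n
      · have := s.2.2.2 ⟨i, hi⟩
        simpa [Nat.min_eq_left hi.le, Nat.min_eq_left (Nat.succ_le_of_lt hi)] using this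
      · have h1 : min i n = n := by omega
        have h2 : min (i + 1) n = n := by omega
        simp only [h1, h2]
        exact Below.refl _⟩

theorem Chain.extend_apply {K : ℕ} {v : Word} {n : ℕ} (hv : twos v ≤ K) (s : Chain [] v n)
    {i : ℕ} (hi : i ≤ n) : (s.extend hv).1 i = s.1 ⟨i, by omega⟩ := by
  simp [Chain.extend, Nat.min_eq_left hi]

/-- The vertex of a path at a level. -/
def PathSpace.vertex {K : ℕ} (y : PathSpace K) (n : ℕ) : Vertex K :=
  ⟨y.1 n, n, (y.2.2 n).1, fun h => h ▸ y.2.1⟩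

theorem measurableSet_through {K : ℕ} (x : Vertex K) : MeasurableSet (through x) :=
  MeasurableSpace.measurableSet_generateFrom ⟨x, rfl⟩

theorem measurableSet_cylinder {K : ℕ} (y : PathSpace K) (n : ℕ) :
    MeasurableSet (cylinder y n) := by
  have : cylinder y n = ⋂ i ∈ Finset.range (n + 1), through (y.vertex i) := by
    ext z
    simp [cylinder, through, PathSpace.vertex]
  rw [this]
  exact Finset.measurableSet_biInter _ fun i _ => measurableSet_through _

theorem through_eq_iUnion {K : ℕ} (x : Vertex K) :
    through x = ⋃ s : Chain [] x.word x.level, cylinder (s.extend x.twos_le) x.level := by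
  ext z
  rw [Set.mem_iUnion]
  constructor
  · intro hz
    refine ⟨⟨fun i => z.1 i, z.2.1, hz, fun i => (z.2.2 i).2⟩, fun i hi => ?_⟩
    rw [Chain.extend_apply _ _ hi]
  · rintro ⟨s, hs⟩
    have := hs x.level le_rfl
    rw [Chain.extend_apply _ _ le_rfl] at this
    exact this.trans s.2.2.1

theorem disjoint_chain_cylinder {K : ℕ} (x : Vertex K) :
    Pairwise (Function.onFun Disjoint fun s : Chain [] x.word x.level =>
      cylinder (s.extend x.twos_le) x.level) := by
  intro s t hst
  rw [Function.onFun, Set.disjoint_left]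
  intro z hs ht
  apply hst
  apply Subtype.ext
  funext i
  have h1 := hs i (Nat.lt_succ_iff.1 i.2)
  rw [ht i (Nat.lt_succ_iff.1 i.2), Chain.extend_apply _ _ (Nat.lt_succ_iff.1 i.2),
    Chain.extend_apply _ _ (Nat.lt_succ_iff.1 i.2)] at h1
  exact h1.symm

/-- The set is the disjoint union of one cylinder for each chain from ε, since every chain extends
to an infinite path by staying at its end. -/
theorem measure_through {K : ℕ} (M : Measure (PathSpace K)) (x : Vertex K) (c : ℝ≥0∞)
    (h : ∀ y : PathSpace K, y.1 x.level = x.word → M (cylinder y x.level) = c) :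
    M (through x) = D [] x.word x.level * c := by
  have := finite_chain [] x.word x.level
  rw [through_eq_iUnion, measure_iUnion (disjoint_chain_cylinder x)
    fun s => measurableSet_cylinder _ _]
  have hs : ∀ s : Chain [] x.word x.level,
      M (cylinder (s.extend x.twos_le) x.level) = c := fun s => h _ <| by
    rw [Chain.extend_apply _ _ le_rfl]
    exact s.2.2.1
  simp only [hs]
  rw [ENNReal.tsum_const, ENat.card_eq_coe_natCard]
  rfl

theorem generateFrom_cylinder (K : ℕ) :
    (inferInstance : MeasurableSpace (PathSpace K)) =
      MeasurableSpace.generateFrom {s | ∃ (y : PathSpace K) (n : ℕ), s = cylinder y n} := by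
  apply le_antisymm
  · refine MeasurableSpace.generateFrom_le ?_
    rintro _ ⟨x, rfl⟩
    have := finite_chain [] x.word x.level
    rw [through_eq_iUnion]
    refine MeasurableSet.iUnion fun s => ?_
    exact MeasurableSpace.measurableSet_generateFrom ⟨_, _, rfl⟩
  · refine MeasurableSpace.generateFrom_le ?_
    rintro _ ⟨y, n, rfl⟩
    exact measurableSet_cylinder y n

theorem isPiSystem_cylinder (K : ℕ) :
    IsPiSystem {s | ∃ (y : PathSpace K) (n : ℕ), s = cylinder y n} := by
  rintro _ ⟨y, n, rfl⟩ _ ⟨z, m, rfl⟩ ⟨t, ht, ht'⟩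
  refine ⟨t, max n m, ?_⟩
  ext u
  constructor
  · rintro ⟨h1, h2⟩ i hi
    rcases le_max_iff.1 hi with h | h
    · rw [h1 i h, ht i h]
    · rw [h2 i h, ht' i h]
  · intro h
    exact ⟨fun i hi => (h i (hi.trans (le_max_left _ _))).trans (ht i hi),
      fun i hi => (h i (hi.trans (le_max_right _ _))).trans (ht' i hi)⟩

/-- Centrality recovers the measure of a cylinder as that of its end vertex divided by a nonzero
number of chains, and cylinders form a generating π-system. -/
theorem central_unique {K : ℕ} {M M' : Measure (PathSpace K)} [IsProbabilityMeasure M]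
    [IsProbabilityMeasure M'] (hM : IsCentral M) (hM' : IsCentral M')
    (h : ∀ x : Vertex K, M (through x) = M' (through x)) : M = M' := by
  refine ext_of_generate_finite _ (generateFrom_cylinder K) (isPiSystem_cylinder K) ?_ (by simp)
  rintro _ ⟨y, n, rfl⟩
  have h1 := measure_through M (y.vertex n) _ fun z hz => hM n z y hz
  have h2 := measure_through M' (y.vertex n) _ fun z hz => hM' n z y hz
  have h3 := h (y.vertex n)
  rw [h1, h2] at h3
  refine (ENNReal.mul_right_inj ?_ (ENNReal.natCast_ne_top _)).1 h3
  rw [Nat.cast_ne_zero]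
  change D [] (y.1 n) n ≠ 0
  rcases eq_or_ne n 0 with rfl | hn
  · rw [y.2.1, D_self]; exact one_ne_zero
  · exact (D_pos (below_nil _) hn).ne'

/-! ### Construction of central measures from harmonic functions -/

/-- The words with at most `K` twos. -/
abbrev State (K : ℕ) : Type := {w : Word // twos w ≤ K}

/-- The possible successors of a word on a path. -/
abbrev Successor {K : ℕ} (w : State K) : Type := {u : Word // twos u ≤ K ∧ Below w.1 u}

instance {K : ℕ} (w : State K) : MeasurableSpace (Successor w) := ⊤

instance : Countable Digit := by
  refine Function.Injective.countable (f := fun a : Digit => if a = Digit.one then 0 else 1) ?_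
  intro a b
  cases a <;> cases b <;> simp

/-- The path determined by a choice of successors. -/
def walk {K : ℕ} (ω : ∀ i : ℕ × State K, Successor i.2) : ℕ → State K
  | 0 => ⟨[], by simp⟩
  | n + 1 => ⟨(ω (n, walk ω n)).1, (ω (n, walk ω n)).2.1⟩

/-- The path determined by a choice of successors, as an element of the path space. -/
def toPath {K : ℕ} (ω : ∀ i : ℕ × State K, Successor i.2) : PathSpace K :=
  ⟨fun n => (walk ω n).1, rfl, fun n => ⟨(walk ω n).2, (ω (n, walk ω n)).2.2⟩⟩

theorem measurableSet_walk {K : ℕ} (n : ℕ) (w : State K) :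
    MeasurableSet {ω : ∀ i : ℕ × State K, Successor i.2 | walk ω n = w} := by
  induction n generalizing w with
  | zero =>
    simp only [walk]
    exact MeasurableSet.const _
  | succ n ih =>
    have : {ω : ∀ i : ℕ × State K, Successor i.2 | walk ω (n + 1) = w} =
        ⋃ u : State K, {ω | walk ω n = u} ∩
          (fun ω : ∀ i : ℕ × State K, Successor i.2 => ω (n, u)) ⁻¹' {a | a.1 = w.1} := by
      ext ω
      simp only [Set.mem_ofPred_eq, Set.mem_iUnion, Set.mem_inter_iff, Set.mem_preimage]
      constructor
      · intro h
        exact ⟨walk ω n, rfl, congrArg Subtype.val h⟩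
      · rintro ⟨u, rfl, h⟩
        exact Subtype.ext h
    rw [this]
    refine MeasurableSet.iUnion fun u => (ih u).inter ?_
    exact measurable_pi_apply _ (MeasurableSpace.measurableSet_top)

theorem measurable_toPath (K : ℕ) : Measurable (toPath (K := K)) := by
  refine measurable_generateFrom ?_
  rintro _ ⟨x, rfl⟩
  convert measurableSet_walk x.level ⟨x.word, x.twos_le⟩ using 1
  ext ω
  exact ⟨fun h => Subtype.ext h, fun h => congrArg Subtype.val h⟩

theorem toPath_mem_cylinder {K : ℕ} (y : PathSpace K) (n : ℕ)
    (ω : ∀ i : ℕ × State K, Successor i.2) :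
    toPath ω ∈ cylinder y n ↔
      ∀ i < n, (ω (i, ⟨y.1 i, (y.2.2 i).1⟩)).1 = y.1 (i + 1) := by
  induction n with
  | zero =>
    simp only [not_lt_zero, false_implies, implies_true, iff_true]
    intro i hi
    obtain rfl : i = 0 := by omega
    exact y.2.1.symm
  | succ n ih =>
    have h1 : toPath ω ∈ cylinder y (n + 1) ↔
        toPath ω ∈ cylinder y n ∧ (walk ω (n + 1)).1 = y.1 (n + 1) := by
      constructor
      · exact fun h => ⟨fun i hi => h i (by omega), h (n + 1) le_rfl⟩
      · rintro ⟨h, h'⟩ i hi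
        rcases Nat.le_succ_iff.1 hi with hi | rfl
        · exact h i hi
        · exact h'
    rw [h1, Nat.forall_lt_succ_right, ← ih]
    refine and_congr_right fun h => ?_
    have h2 : walk ω n = ⟨y.1 n, (y.2.2 n).1⟩ := Subtype.ext (h n le_rfl)
    change (ω (n, walk ω n)).1 = _ ↔ _
    rw [h2]

section construction

variable {K : ℕ} (φ : Word → ℕ → ℝ≥0∞)

open Classical in
/-- The transition probabilities of the Markov chain with harmonic function `φ`. -/
noncomputable def transition (i : ℕ × State K) : PMF (Successor i.2) :=
  if h : (∑' u : Successor i.2, φ u.1 (i.1 + 1)) ≠ 0 ∧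
      (∑' u : Successor i.2, φ u.1 (i.1 + 1)) ≠ ∞ then
    PMF.normalize (fun u : Successor i.2 => φ u.1 (i.1 + 1)) h.1 h.2
  else PMF.pure ⟨i.2.1, i.2.2, Below.refl _⟩

/-- The law of the independent choices of successors. -/
noncomputable def choiceLaw : Measure (∀ i : ℕ × State K, Successor i.2) :=
  Measure.infinitePi fun i => (transition φ i).toMeasure

instance : IsProbabilityMeasure (choiceLaw (K := K) φ) := by
  unfold choiceLaw; infer_instance

variable {φ}

theorem mul_transition (hfin : ∀ w l, φ w l ≠ ∞)
    (hharm : ∀ (w : State K) (l : ℕ), ∑' u : Successor w, φ u.1 (l + 1) = φ w.1 l)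
    (w : State K) (l : ℕ) (u : Successor w) :
    φ w.1 l * (transition φ (l, w)).toMeasure {a | a.1 = u.1} = φ u.1 (l + 1) := by
  have h2 := hharm w l
  have h3 : {a : Successor w | a.1 = u.1} = {u} := by
    ext a
    exact ⟨fun h => Subtype.ext h, fun h => congrArg Subtype.val h⟩
  rw [h3, PMF.toMeasure_apply_singleton _ _ MeasurableSpace.measurableSet_top]
  -- Where φ vanishes the transition law has an arbitrary default value, but by harmonicity φ also
  -- vanishes at every successor, so both sides are 0.
  by_cases hz : φ w.1 l = 0
  · rw [hz, zero_mul]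
    rw [hz, ENNReal.tsum_eq_zero] at h2
    exact (h2 u).symm
  · rw [transition, dif_pos (by rw [h2]; exact ⟨hz, hfin _ _⟩), PMF.normalize_apply, h2,
      mul_left_comm, ENNReal.mul_inv_cancel hz (hfin _ _), mul_one]

/-- A cylinder restricts only the choices at the pairs (i, y_i) with i < n. These pairs differ in
time, so the choices are independent and the product of transition probabilities telescopes to φ at
the end. -/
theorem choiceLaw_cylinder (h0 : φ [] 0 = 1) (hfin : ∀ w l, φ w l ≠ ∞)
    (hharm : ∀ (w : State K) (l : ℕ), ∑' u : Successor w, φ u.1 (l + 1) = φ w.1 l)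
    (y : PathSpace K) (n : ℕ) :
    choiceLaw (K := K) φ (toPath ⁻¹' cylinder y n) = φ (y.1 n) n := by
  classical
  set s : ℕ → State K := fun i => ⟨y.1 i, (y.2.2 i).1⟩ with hs
  have h1 : toPath ⁻¹' cylinder y n =
      Set.pi ((Finset.range n).image (fun i => (i, s i)) : Finset (ℕ × State K))
      fun i : ℕ × State K => {u : Successor i.2 | u.1 = y.1 (i.1 + 1)} := by
    ext ω
    rw [Set.mem_preimage, toPath_mem_cylinder]
    simp [hs, Set.pi]
  rw [h1, choiceLaw, Measure.infinitePi_pi _ fun i _ => MeasurableSpace.measurableSet_top,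
    Finset.prod_image fun i _ j _ h => (Prod.mk.inj h).1]
  clear h1
  induction n with
  | zero => rw [Finset.range_zero, Finset.prod_empty, y.2.1, h0]
  | succ n ih =>
    rw [Finset.prod_range_succ, ih]
    exact mul_transition hfin hharm (s n) n ⟨y.1 (n + 1), (y.2.2 (n + 1)).1, (y.2.2 n).2⟩

theorem hasCentralMeasure_of_harmonic (h0 : φ [] 0 = 1) (hfin : ∀ w l, φ w l ≠ ∞)
    (hharm : ∀ (w : State K) (l : ℕ), ∑' u : Successor w, φ u.1 (l + 1) = φ w.1 l)
    {μ : Vertex K → ℝ}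
    (hμ : ∀ x : Vertex K, ENNReal.ofReal (μ x) = D [] x.word x.level * φ x.word x.level) :
    HasCentralMeasure μ := by
  have hcyl : ∀ (y : PathSpace K) (n : ℕ),
      (choiceLaw (K := K) φ).map toPath (cylinder y n) = φ (y.1 n) n := fun y n => by
    rw [Measure.map_apply (measurable_toPath K) (measurableSet_cylinder y n),
      choiceLaw_cylinder h0 hfin hharm]
  have hthrough : ∀ x : Vertex K, (choiceLaw (K := K) φ).map toPath (through x) =
      ENNReal.ofReal (μ x) := fun x => by
    rw [hμ, measure_through _ x (φ x.word x.level)]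
    intro y hy
    rw [hcyl, hy]
  have hprob := Measure.isProbabilityMeasure_map (μ := choiceLaw (K := K) φ)
    (measurable_toPath K).aemeasurable
  have hcen : IsCentral ((choiceLaw (K := K) φ).map toPath) := fun n y z h => by
    rw [hcyl, hcyl, h]
  refine ⟨(choiceLaw (K := K) φ).map toPath, ⟨hprob, hcen, hthrough⟩, ?_⟩
  rintro M ⟨h1, h2, h3⟩
  exact central_unique h2 hcen fun x => by rw [h3, hthrough]

end construction

theorem hasCentralMeasure_mu {K : ℕ} {v : Word} {p : ℝ} (hv : twos v ≤ K)
    (hp : p ∈ Set.Ioo (0 : ℝ) 1) : HasCentralMeasure (K := K) (mu v p) := by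
  classical
  refine hasCentralMeasure_of_harmonic (φ := fun w l => ENNReal.ofReal (p ^ l * psi v p w))
    (by simp [psi_nil hp]) (fun _ _ => ENNReal.ofReal_ne_top) ?_ ?_
  · intro w l
    have h1 := (hasSum_psi hp v w.1).mul_left (p ^ l)
    have hnn : ∀ u, 0 ≤ p ^ l * (if Below w.1 u then p * psi v p u else 0) := fun u => by
      have := psi_nonneg hp v u
      have := hp.1.le
      split_ifs <;> positivity
    rw [← h1.tsum_eq, ENNReal.ofReal_tsum_of_nonneg hnn h1.summable]
    change ∑' u : {u : Word | twos u ≤ K ∧ Below w.1 u},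
      ENNReal.ofReal (p ^ (l + 1) * psi v p u.1) = _
    rw [tsum_subtype {u : Word | twos u ≤ K ∧ Below w.1 u}
      (fun u => ENNReal.ofReal (p ^ (l + 1) * psi v p u))]
    refine tsum_congr fun u => ?_
    by_cases hb : Below w.1 u
    · rw [if_pos hb]
      by_cases hu : twos u ≤ K
      · rw [Set.indicator_of_mem (show u ∈ {u | twos u ≤ K ∧ Below w.1 u} from ⟨hu, hb⟩),
           pow_succ, mul_assoc]
      · rw [Set.indicator_of_notMem fun h => hu h.1]
        -- Harmonicity was proved over all words; those with more than K twos carry no mass, so the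
        -- sum may be restricted to the graph.
        have : psi v p u = 0 := by
          by_contra hne
          apply hu
          rcases (psi_ne_zero hp).1 hne with h | ⟨W, -, rfl⟩
          · exact h.twos_le.trans hv
          · simpa using hv
        simp [this]
    · rw [if_neg hb, Set.indicator_of_notMem fun h => hb h.2]
      simp
  · intro x
    rw [mu_eq, mul_assoc, ENNReal.ofReal_mul (Nat.cast_nonneg _), ENNReal.ofReal_natCast]

theorem hasCentralMeasure_muOne (K : ℕ) : HasCentralMeasure (K := K) muOne := by
  classical
  refine hasCentralMeasure_of_harmonic (φ := fun w _ => if w = [] then 1 else 0)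
    (by simp) (fun w _ => by split_ifs <;> simp) ?_ ?_
  · intro w l
    by_cases hw : w.1 = []
    · rw [if_pos hw, tsum_eq_single (⟨[], by simp, by rw [hw]; exact Below.refl _⟩ : Successor w)]
      · simp
      · intro u hu
        rw [if_neg]
        exact fun h => hu (Subtype.ext h)
    · rw [if_neg hw, ENNReal.tsum_eq_zero]
      intro u
      rw [if_neg]
      intro h
      have := u.2.2
      rw [h, below_nil_right] at this
      exact hw this
  · intro x
    unfold muOne
    split_ifs with h
    · rw [h, D_self]; simp
    · simp

/-- Every path passes through one of the countably many vertices of level 1. -/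
theorem eq_zero_of_through {K : ℕ} {M : Measure (PathSpace K)}
    (h : ∀ x : Vertex K, 1 ≤ x.level → M (through x) = 0) : M = 0 := by
  rw [← Measure.measure_univ_eq_zero]
  have : (Set.univ : Set (PathSpace K)) = ⋃ w : State K,
      through (⟨w.1, 1, w.2, by simp⟩ : Vertex K) := by
    ext y
    simp only [Set.mem_univ, Set.mem_iUnion, true_iff]
    exact ⟨⟨y.1 1, (y.2.2 1).1⟩, rfl⟩
  rw [this, measure_iUnion_null_iff]
  exact fun w => h _ le_rfl

/-! ### Parameter words and distinctness -/

theorem setOf_paramWord (K : ℕ) :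
    {v : Word | ∃ c : List ℕ, c.length ≤ K ∧ v = paramWord c} =
      {v : Word | v = [] ∨ ∃ u : Word, twos u + 1 ≤ K ∧ v = Digit.two :: u} := by
  ext v
  constructor
  · rintro ⟨c, hc, rfl⟩
    cases c with
    | nil => exact Or.inl rfl
    | cons a c =>
      refine Or.inr ⟨_, ?_, rfl⟩
      simpa [twos_paramWord] using hc
  · rintro (rfl | ⟨u, hu, rfl⟩)
    · exact ⟨[], Nat.zero_le _, rfl⟩
    · obtain ⟨j, c, rfl⟩ := exists_eq_replicate_append u
      refine ⟨j :: c, ?_, rfl⟩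
      simpa [twos_paramWord] using hu

theorem replicate_append_paramWord_inj {i j : ℕ} {c c' : List ℕ}
    (h : List.replicate i Digit.one ++ paramWord c = List.replicate j Digit.one ++ paramWord c') :
    i = j ∧ paramWord c = paramWord c' := by
  induction i generalizing j with
  | zero =>
    cases j with
    | zero => exact ⟨rfl, h⟩
    | succ j => cases c <;> simp [paramWord, List.replicate_succ] at h
  | succ i ih =>
    cases j with
    | zero => cases c' <;> simp [paramWord, List.replicate_succ] at h
    | succ j =>
      simp only [List.replicate_succ, List.cons_append, List.cons.injEq, true_and] at h
      obtain ⟨rfl, h'⟩ := ih h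
      exact ⟨rfl, h'⟩

theorem paramWord_injective : Function.Injective paramWord := by
  intro c c' h
  induction c generalizing c' with
  | nil => cases c' <;> simp [paramWord] at h ⊢
  | cons a c ih =>
    cases c' with
    | nil => simp [paramWord] at h
    | cons b c' =>
      simp only [paramWord, List.cons.injEq, true_and] at h
      obtain ⟨rfl, h'⟩ := replicate_append_paramWord_inj h
      rw [ih h']

theorem mu_nil {K : ℕ} {v : Word} {p : ℝ} (hp : p ∈ Set.Ioo (0 : ℝ) 1) :
    mu v p (⟨[], 1, by simp, by simp⟩ : Vertex K) = p := by
  simp [mu_eq, psi_nil hp, D_self]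

theorem mu_ne_zero {K : ℕ} {v w : Word} {p : ℝ} (hp : p ∈ Set.Ioo (0 : ℝ) 1)
    (hw : twos w ≤ K) :
    mu v p (⟨w, 1, hw, by simp⟩ : Vertex K) ≠ 0 ↔
      Below w v ∨ ∃ W : ℕ, 1 ≤ W ∧ w = List.replicate W Digit.one ++ v := by
  rw [← psi_ne_zero hp, mu_eq]
  have hD : D [] w 1 = 1 := by rw [D_one, if_pos (below_nil w)]
  simp [hD, hp.1.ne']

/-- The word of c lies in the support on level 1, hence in that of c'. It is empty or begins with a
two, so it cannot be of the form 1^W followed by the word of c' with W ≥ 1. -/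
theorem below_paramWord_of_mu_eq {K : ℕ} {c c' : List ℕ} {p p' : ℝ} (hc : c.length ≤ K)
    (hp : p ∈ Set.Ioo (0 : ℝ) 1) (hp' : p' ∈ Set.Ioo (0 : ℝ) 1)
    (h : mu (K := K) (paramWord c) p = mu (paramWord c') p') :
    Below (paramWord c) (paramWord c') := by
  have hw : twos (paramWord c) ≤ K := by rwa [twos_paramWord]
  have h1 := (mu_ne_zero (K := K) hp hw).2 (Or.inl (Below.refl (paramWord c)))
  rw [h, mu_ne_zero hp' hw] at h1
  rcases h1 with h1 | ⟨W, hW, h1⟩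
  · exact h1
  · have := (replicate_append_paramWord_inj (i := 0) (j := W) h1).1
    omega

theorem mu_injective {K : ℕ} {c c' : List ℕ} {p p' : ℝ} (hc : c.length ≤ K)
    (hc' : c'.length ≤ K) (hp : p ∈ Set.Ioo (0 : ℝ) 1) (hp' : p' ∈ Set.Ioo (0 : ℝ) 1)
    (h : mu (K := K) (paramWord c) p = mu (paramWord c') p') : c = c' ∧ p = p' := by
  refine ⟨paramWord_injective ((below_paramWord_of_mu_eq hc hp hp' h).antisymm
    (below_paramWord_of_mu_eq hc' hp' hp h.symm)), ?_⟩
  have := congrFun h ⟨[], 1, by simp, by simp⟩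
  rwa [mu_nil hp, mu_nil hp'] at this

theorem mu_ne {K : ℕ} {v : Word} {p : ℝ} (hp : p ∈ Set.Ioo (0 : ℝ) 1) :
    mu (K := K) v p ≠ muZero ∧ mu (K := K) v p ≠ muOne := by
  constructor
  · intro h
    have := congrFun h ⟨[], 1, by simp, by simp⟩
    rw [mu_nil hp] at this
    exact hp.1.ne' (by simpa [muZero] using this)
  · intro h
    have := congrFun h ⟨[], 1, by simp, by simp⟩
    rw [mu_nil hp] at this
    exact hp.2.ne (by simpa [muOne] using this)

theorem muZero_ne_muOne (K : ℕ) : (muZero : Vertex K → ℝ) ≠ muOne := by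
  intro h
  have := congrFun h ⟨[], 1, by simp, by simp⟩
  simp [muZero, muOne] at this

theorem measure_muZero_iff {K : ℕ} (M : Measure (PathSpace K)) :
    (∀ x : Vertex K, 1 ≤ x.level → M (through x) = ENNReal.ofReal (muZero x)) ↔ M = 0 := by
  have h0 : ∀ x : Vertex K, 1 ≤ x.level → ENNReal.ofReal (muZero x) = 0 := fun x hx => by
    rw [muZero, if_neg (by omega), ENNReal.ofReal_zero]
  constructor
  · intro h
    exact eq_zero_of_through fun x hx => (h x hx).trans (h0 x hx)
  · rintro rfl x hx
    rw [h0 x hx]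
    rfl

end JumpYF

theorem mainTheorem1 (K : ℕ) :
    -- every limit function of a sequence of vertices with unbounded levels is in the list
    (∀ (V : ℕ → Vertex K) (μ : Vertex K → ℝ),
      ¬ BddAbove (Set.range fun m => (V m).level) → IsLimit V μ →
        (∃ (c : List ℕ) (p : ℝ), c.length ≤ K ∧ p ∈ Set.Ioo (0 : ℝ) 1 ∧ μ = mu (paramWord c) p) ∨
          μ = muZero ∨ μ = muOne) ∧
    -- everything in the list occurs
    (∀ μ : Vertex K → ℝ,
      ((∃ (c : List ℕ) (p : ℝ), c.length ≤ K ∧ p ∈ Set.Ioo (0 : ℝ) 1 ∧ μ = mu (paramWord c) p) ∨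
          μ = muZero ∨ μ = muOne) →
        ∃ V : ℕ → Vertex K, Tendsto (fun m => (V m).level) atTop atTop ∧ IsLimit V μ) ∧
    -- how the parameters arise from the sequence
    (∀ (V : ℕ → Vertex K) (p : ℝ), Tendsto (fun m => (V m).level) atTop atTop →
      Tendsto (fun m => ((V m).level : ℝ) / ((V m).level + (V m).word.length)) atTop (𝓝 p) →
        (∀ c : List ℕ, c.length ≤ K → p ∈ Set.Ioo (0 : ℝ) 1 →
          (∀ N : ℕ, ∀ᶠ m in atTop,
            (List.replicate N Digit.one ++ paramWord c) <:+ (V m).word) →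
          IsLimit V (mu (paramWord c) p)) ∧
        (p = 0 → IsLimit V muZero) ∧
        (p = 1 → IsLimit V muOne)) ∧
    -- the other description of the set of words that occur as parameters
    ({v : Word | ∃ c : List ℕ, c.length ≤ K ∧ v = paramWord c} =
      {v : Word | v = [] ∨ ∃ u : Word, twos u + 1 ≤ K ∧ v = Digit.two :: u}) ∧
    -- the measures on the space of infinite paths
    (∀ (c : List ℕ) (p : ℝ), c.length ≤ K → p ∈ Set.Ioo (0 : ℝ) 1 →
      HasCentralMeasure (K := K) (mu (paramWord c) p)) ∧
    HasCentralMeasure (K := K) muOne ∧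
    (∀ M : Measure (PathSpace K),
      (∀ x : Vertex K, 1 ≤ x.level → M (through x) = ENNReal.ofReal (muZero x)) ↔ M = 0) ∧
    -- they are pairwise distinct
    (∀ (c c' : List ℕ) (p p' : ℝ), c.length ≤ K → c'.length ≤ K →
      p ∈ Set.Ioo (0 : ℝ) 1 → p' ∈ Set.Ioo (0 : ℝ) 1 →
      (mu (K := K) (paramWord c) p = mu (paramWord c') p' → c = c' ∧ p = p')) ∧
    (∀ (c : List ℕ) (p : ℝ), c.length ≤ K → p ∈ Set.Ioo (0 : ℝ) 1 →
      mu (K := K) (paramWord c) p ≠ muZero ∧ mu (K := K) (paramWord c) p ≠ muOne) ∧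
    (muZero : Vertex K → ℝ) ≠ muOne := by
  refine ⟨fun V μ => limit_classification, ?_, ?_, setOf_paramWord K, ?_, hasCentralMeasure_muOne K,
    measure_muZero_iff, fun c c' p p' => mu_injective, fun c p _ => mu_ne, muZero_ne_muOne K⟩
  · rintro μ (⟨c, p, hc, hp, rfl⟩ | rfl | rfl)
    · exact exists_isLimit_mu hc hp
    · exact exists_isLimit_muZero K
    · exact exists_isLimit_muOne K
  · intro V p hn hr
    refine ⟨fun c _ hp hv => isLimit_mu hn hr hp hv, ?_, ?_⟩
    · rintro rfl
      exact isLimit_muZero hn hr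
    · rintro rfl
      exact isLimit_muOne hn hr
  · intro c p hc hp
    exact hasCentralMeasure_mu (by rwa [twos_paramWord]) hp
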